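/- Let $X$ be an infinite-dimensional complex Banach space and let $A$ be a closed, densely defined linear operator on $X$ with domain $\mathcal D(A)$, null space $\mathcal N(A)$ and range $\mathcal R(A)$. The powers $A^n$ ($n\ge 0$) are taken on their natural domains $\mathcal D(A^n)=\{x\in X: x,Ax,\dots,A^{n-1}x\in\mathcal D(A)\}$, with $A^0=I$ on $\mathcal D(A^0)=X$. An operator is called Fredholm if its range is closed and of finite codimension and its null space is finite-dimensional; it is called Browder if it is Fredholm and has finite ascent ($\mathcal N(A^n)=\mathcal N(A^{n+1})$ for some $n\ge 0$) and finite descent ($\mathcal R(A^n)=\mathcal R(A^{n+1})$ for some $n\ge 0$). Put $\sigma_e(A)=\{\lambda\in\mathbb C: A-\lambda \text{ is not Fredholm}\}$, $\rho_e(A)=\mathbb C\setminus\sigma_e(A)$ and $\sigma_b(A)=\{\lambda\in\mathbb C: A-\lambda\text{ is not Browder}\}$. A bounded operator $T$ on $X$ is called Riesz if $\sigma_e(T)=\{0\}$. The operator $A$ is called generalized Drazin-Riesz invertible if there is a bounded operator $B$ on $X$ such that $\mathcal R(B)\subset\mathcal D(A)$, $\mathcal R(I-AB)\subset\mathcal D(A)$,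 $BAB=B$, $BAx=ABx$ for all $x\in\mathcal D(A)$, and $A(I-AB)$ is a bounded Riesz operator. Assume that $\rho_e(A)\neq\emptyset$ and that $\mathcal D(A^{j+1})=\mathcal D(A^j)$ for all sufficiently large $j$. Then the following are equivalent: (i) $A$ is generalized Drazin-Riesz invertible; (ii) $0$ is not an accumulation point of $\sigma_b(A)$. -/

import Mathlib

open Filter Topology

namespace UnboundedOp

variable {X : Type*} [NormedAddCommGroup X] [NormedSpace ℂ X]

/-- The natural domain `{x ∈ D(f) : f x ∈ D(g)}` of the composition `g ∘ f`. -/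
def compDomain (g f : X →ₗ.[ℂ] X) : Submodule ℂ X :=
  (g.domain.comap f.toFun).map f.domain.subtype

theorem mem_compDomain {g f : X →ₗ.[ℂ] X} {x : X} :
    x ∈ compDomain g f ↔ ∃ h : x ∈ f.domain, f ⟨x, h⟩ ∈ g.domain := by
  constructor
  · rintro ⟨y, hy, rfl⟩
    exact ⟨y.2, hy⟩
  · rintro ⟨h, hx⟩
    exact ⟨⟨x, h⟩, hx, rfl⟩

/-- The composition `g ∘ f` of two partially defined operators on its natural domain. -/
def comp (g f : X →ₗ.[ℂ] X) : X →ₗ.[ℂ] X where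
  domain := compDomain g f
  toFun :=
    { toFun := fun x => g ⟨f ⟨x, (mem_compDomain.1 x.2).1⟩, (mem_compDomain.1 x.2).2⟩
      map_add' := fun x y => by
        rw [← LinearPMap.map_add]
        congr 1
        exact Subtype.ext (LinearPMap.map_add f
          ⟨x, (mem_compDomain.1 x.2).1⟩ ⟨y, (mem_compDomain.1 y.2).1⟩)
      map_smul' := fun c x => by
        rw [RingHom.id_apply, ← LinearPMap.map_smul]
        congr 1
        exact Subtype.ext (LinearPMap.map_smul f c ⟨x, (mem_compDomain.1 x.2).1⟩) }

/-- The powers of an operator, `D(A ^ n) = {x : x, A x, …, A ^ (n - 1) x ∈ D(A)}`; the power `0` is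
the identity on the whole space. -/
def pow (A : X →ₗ.[ℂ] X) : ℕ → (X →ₗ.[ℂ] X)
  | 0 => (LinearMap.id : X →ₗ[ℂ] X).toPMap ⊤
  | n + 1 => comp A (pow A n)

/-- The operator `A - μ`, with domain `D(A)`. -/
def subScalar (A : X →ₗ.[ℂ] X) (μ : ℂ) : X →ₗ.[ℂ] X :=
  (-(μ • (LinearMap.id : X →ₗ[ℂ] X))) +ᵥ A

/-- The null space `{x ∈ D(A) : A x = 0}`, as a subspace of `X`. -/
def nullSpace (A : X →ₗ.[ℂ] X) : Submodule ℂ X :=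
  (LinearMap.ker A.toFun).map A.domain.subtype

/-- The range `{A x : x ∈ D(A)}`. -/
def range (A : X →ₗ.[ℂ] X) : Submodule ℂ X :=
  LinearMap.range A.toFun

/-- Fredholm: closed range, finite-dimensional null space, range of finite codimension. -/
structure IsFredholm (A : X →ₗ.[ℂ] X) : Prop where
  isClosed_range : IsClosed (range A : Set X)
  finite_nullSpace : FiniteDimensional ℂ (nullSpace A)
  finite_coker : FiniteDimensional ℂ (X ⧸ range A)

def HasFiniteAscent (A : X →ₗ.[ℂ] X) : Prop :=
  ∃ n : ℕ, nullSpace (pow A n) = nullSpace (pow A (n + 1))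

def HasFiniteDescent (A : X →ₗ.[ℂ] X) : Prop :=
  ∃ n : ℕ, range (pow A n) = range (pow A (n + 1))

/-- Browder: Fredholm of finite ascent and finite descent. -/
structure IsBrowder (A : X →ₗ.[ℂ] X) : Prop where
  isFredholm : IsFredholm A
  finiteAscent : HasFiniteAscent A
  finiteDescent : HasFiniteDescent A

def essentialSpectrum (A : X →ₗ.[ℂ] X) : Set ℂ :=
  {μ | ¬ IsFredholm (subScalar A μ)}

def essentialResolvent (A : X →ₗ.[ℂ] X) : Set ℂ :=
  (essentialSpectrum A)ᶜ

def browderSpectrum (A : X →ₗ.[ℂ] X) : Set ℂ :=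
  {μ | ¬ IsBrowder (subScalar A μ)}

/-- A bounded operator is Riesz if its essential spectrum is `{0}`. -/
def IsRiesz (T : X →L[ℂ] X) : Prop :=
  essentialSpectrum ((T : X →ₗ[ℂ] X).toPMap ⊤) = {0}

/-- The bounded operator `B` is a generalized Drazin-Riesz inverse of `A`: the ranges of `B` and of
`I - A B` lie in `D(A)`, `B A B = B`, `B A x = A B x` for `x ∈ D(A)`, and `A (I - A B)` is a bounded
Riesz operator. -/
def IsGeneralizedDrazinRieszInverse (A : X →ₗ.[ℂ] X) (B : X →L[ℂ] X) : Prop :=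
  ∃ (hB : ∀ x : X, B x ∈ A.domain) (hAB : ∀ x : X, x - A ⟨B x, hB x⟩ ∈ A.domain),
    (∀ x : X, B (A ⟨B x, hB x⟩) = B x) ∧
    (∀ x : A.domain, B (A x) = A ⟨B x, hB x⟩) ∧
    ∃ T : X →L[ℂ] X, (∀ x : X, T x = A ⟨x - A ⟨B x, hB x⟩, hAB x⟩) ∧ IsRiesz T

def IsGeneralizedDrazinRieszInvertible (A : X →ₗ.[ℂ] X) : Prop :=
  ∃ B : X →L[ℂ] X, IsGeneralizedDrazinRieszInverse A B

end UnboundedOp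

/-! The hypotheses force `A` to be bounded. If `A - μ` is Fredholm, every `D(A ^ n)` is dense, so X
= R(A - μ) + D(A ^ n). This decomposition pulls an equality of consecutive domains down one step at
a time to D(A) = X (`domain_eq_top`), and the closed graph theorem gives `A = total T`.

For bounded `T` the main tool is `isBrowder_total_of_mem_closure`: a Fredholm operator that is a
limit of invertible `T - μ` is Browder. Conversely, a Browder operator is invertible at all small
nonzero shifts.

(i) ⇒ (ii): put N = T(1 - TB). For small μ ≠ 0, T - μ is N - μ times a unit
(`exists_isUnit_sub_eq_mul`). N - μ is Fredholm on the connected set ℂ \ {0} and invertible for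
large μ, so every μ ≠ 0 is a limit of resolvent points of N. This passes to T near 0, and the
criterion applies.

(ii) ⇒ (i): if T is Fredholm, it is Browder by the criterion; B inverts T off its finite-dimensional
nilpotent part. If not, the spectrum is discrete in a punctured disc, so some annulus around 0
misses it. The Laurent coefficients of the resolvent there split T, and B inverts the outer part.
Then N has spectral radius at most the inner radius r, while N - μ inherits Fredholmness from T - μ
for 0 < |μ| < s, with s > r the outer radius. -/

namespace UnboundedOp

/-! ### Domains of powers; reduction to an everywhere defined operator. -/

section Domains

variable {X : Type*} [NormedAddCommGroup X] [NormedSpace ℂ X]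

/-- On graphs, composition becomes composition of relations, free of domain proofs inside terms. -/
theorem mem_graph_comp {g f : X →ₗ.[ℂ] X} {x y : X} :
    (x, y) ∈ (comp g f).graph ↔ ∃ z, (x, z) ∈ f.graph ∧ (z, y) ∈ g.graph := by
  simp only [LinearPMap.mem_graph_iff]
  constructor
  · rintro ⟨a, ha, hy⟩
    obtain ⟨h₁, h₂⟩ := mem_compDomain.1 a.2
    exact ⟨f ⟨a, h₁⟩, ⟨⟨a, h₁⟩, ha, rfl⟩, ⟨⟨_, h₂⟩, rfl, hy⟩⟩
  · rintro ⟨z, ⟨a, rfl, rfl⟩, ⟨b, hb, rfl⟩⟩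
    have hmem : (a : X) ∈ compDomain g f := mem_compDomain.2 ⟨a.2, hb ▸ b.2⟩
    refine ⟨⟨a, hmem⟩, rfl, ?_⟩
    change g ⟨f ⟨a, _⟩, _⟩ = g b
    congr 1
    exact Subtype.ext hb.symm

theorem mem_graph_pow_succ {A : X →ₗ.[ℂ] X} {n : ℕ} {x y : X} :
    (x, y) ∈ (pow A (n + 1)).graph ↔ ∃ z, (x, z) ∈ (pow A n).graph ∧ (z, y) ∈ A.graph :=
  mem_graph_comp

theorem mem_graph_pow_zero {A : X →ₗ.[ℂ] X} {x y : X} :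
    (x, y) ∈ (pow A 0).graph ↔ x = y := by
  simp [pow, LinearPMap.mem_graph_iff]

theorem mem_graph_pow_succ' {A : X →ₗ.[ℂ] X} {n : ℕ} {x y : X} :
    (x, y) ∈ (pow A (n + 1)).graph ↔ ∃ z, (x, z) ∈ A.graph ∧ (z, y) ∈ (pow A n).graph := by
  induction n generalizing y with
  | zero =>
    rw [mem_graph_pow_succ]
    simp only [mem_graph_pow_zero]
    exact ⟨fun ⟨z, h, h'⟩ => ⟨y, h ▸ h', rfl⟩, fun ⟨z, h, h'⟩ => ⟨x, rfl, h' ▸ h⟩⟩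
  | succ n ih =>
    rw [mem_graph_pow_succ]
    simp only [ih]
    constructor
    · rintro ⟨z, ⟨w, hw, hwz⟩, hz⟩
      exact ⟨w, hw, mem_graph_pow_succ.2 ⟨z, hwz, hz⟩⟩
    · rintro ⟨w, hw, h⟩
      obtain ⟨z, hwz, hz⟩ := mem_graph_pow_succ.1 h
      exact ⟨z, ⟨w, hw, hwz⟩, hz⟩

theorem domain_pow_zero (A : X →ₗ.[ℂ] X) : (pow A 0).domain = ⊤ := rfl

theorem mem_domain_pow_succ {A : X →ₗ.[ℂ] X} {n : ℕ} {x : X} :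
    x ∈ (pow A (n + 1)).domain ↔ ∃ z, (x, z) ∈ A.graph ∧ z ∈ (pow A n).domain := by
  simp only [LinearPMap.mem_domain_iff, mem_graph_pow_succ']
  constructor
  · rintro ⟨y, z, h₁, h₂⟩
    exact ⟨z, h₁, y, h₂⟩
  · rintro ⟨z, h₁, y, h₂⟩
    exact ⟨y, z, h₁, h₂⟩

theorem domain_pow_succ_le (A : X →ₗ.[ℂ] X) (n : ℕ) :
    (pow A (n + 1)).domain ≤ (pow A n).domain := by
  intro x hx
  obtain ⟨y, hy⟩ := LinearPMap.mem_domain_iff.1 hx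
  obtain ⟨z, hz, -⟩ := mem_graph_pow_succ.1 hy
  exact LinearPMap.mem_domain_iff.2 ⟨z, hz⟩

theorem domain_pow_one (A : X →ₗ.[ℂ] X) : (pow A 1).domain = A.domain := by
  ext x
  rw [mem_domain_pow_succ, LinearPMap.mem_domain_iff]
  exact ⟨fun ⟨z, h, _⟩ => ⟨z, h⟩, fun ⟨z, h⟩ => ⟨z, h, trivial⟩⟩

/-- If `A x - μ x` lies in `D(A ^ n)`, then `x` lies in `D(A ^ (n + 1))`. -/
theorem mem_domain_pow_succ_of_sub_smul_mem {A : X →ₗ.[ℂ] X} {μ : ℂ} {n : ℕ} {x z : X}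
    (hx : (x, z) ∈ A.graph) (hz : z - μ • x ∈ (pow A n).domain) :
    x ∈ (pow A (n + 1)).domain := by
  induction n with
  | zero => exact mem_domain_pow_succ.2 ⟨z, hx, trivial⟩
  | succ n ih =>
    have hxn := ih (domain_pow_succ_le A n hz)
    refine mem_domain_pow_succ.2 ⟨z, hx, ?_⟩
    have := add_mem hz (Submodule.smul_mem _ μ hxn)
    rwa [sub_add_cancel] at this

theorem subScalar_apply (A : X →ₗ.[ℂ] X) (μ : ℂ) (x : A.domain) :
    (subScalar A μ).toFun x = A x - μ • (x : X) := by
  change (-(μ • (LinearMap.id : X →ₗ[ℂ] X))) x + A x = _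
  simp [sub_eq_neg_add]

theorem mem_range_subScalar {A : X →ₗ.[ℂ] X} {μ : ℂ} {y : X} :
    y ∈ range (subScalar A μ) ↔ ∃ x z, (x, z) ∈ A.graph ∧ z - μ • x = y := by
  constructor
  · rintro ⟨x, rfl⟩
    exact ⟨_, _, A.mem_graph x, (subScalar_apply A μ x).symm⟩
  · rintro ⟨x, z, h, rfl⟩
    obtain ⟨a, rfl, rfl⟩ := (LinearPMap.mem_graph_iff _).1 h
    exact ⟨a, subScalar_apply A μ a⟩

/-- A dense subspace `D` admits a continuous map `x ↦ x - s x` into a closed subspace `R` of finite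
codimension, with `s` taking values in `D` and vanishing on `R`. -/
theorem exists_section_of_dense {D R : Submodule ℂ X} (hD : Dense (D : Set X))
    (hR : IsClosed (R : Set X)) [FiniteDimensional ℂ (X ⧸ R)] :
    ∃ s : X → X, Continuous s ∧ (∀ x, s x ∈ D) ∧ (∀ x, x - s x ∈ R) ∧ ∀ x ∈ R, s x = 0 := by
  have := hR
  let q : X →ₗ[ℂ] X ⧸ R := R.mkQ
  have hq : Continuous q := continuous_quot_mk
  have hqs : Function.Surjective q := R.mkQ_surjective
  have hdense : Dense ((D.map q : Submodule ℂ (X ⧸ R)) : Set (X ⧸ R)) := by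
    rw [Submodule.map_coe]
    exact hqs.denseRange.dense_image hq hD
  -- A dense subspace of a finite-dimensional space is everything.
  have htop : D.map q = ⊤ := by
    rw [← SetLike.coe_set_eq, ← (Submodule.closed_of_finiteDimensional (D.map q)).closure_eq,
      hdense.closure_eq]
    rfl
  have hsurj : (q ∘ₗ D.subtype).range = ⊤ := by
    rw [LinearMap.range_comp, Submodule.range_subtype, htop]
  obtain ⟨t, ht⟩ := LinearMap.exists_rightInverse_of_surjective _ hsurj
  let t' : (X ⧸ R) →ₗ[ℂ] X := D.subtype ∘ₗ t
  refine ⟨fun x => t' (q x), (LinearMap.continuous_of_finiteDimensional t').comp hq,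
    fun x => (t (q x)).2, fun x => ?_, fun x hx => ?_⟩
  · rw [← Submodule.Quotient.mk_eq_zero, ← Submodule.mkQ_apply, map_sub, sub_eq_zero]
    exact (LinearMap.congr_fun ht (q x)).symm
  · have : q x = 0 := (Submodule.Quotient.mk_eq_zero R).2 hx
    simp [this]

/-- Open mapping theorem for the map (x, z) ↦ z - μx from the Banach space `A.graph` onto the closed
range. -/
theorem exists_preimage_subScalar_norm_le [CompleteSpace X] {A : X →ₗ.[ℂ] X} (hA : A.IsClosed)
    {μ : ℂ} (hR : IsClosed (range (subScalar A μ) : Set X)) :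
    ∃ C > 0, ∀ y ∈ range (subScalar A μ),
      ∃ x z, (x, z) ∈ A.graph ∧ z - μ • x = y ∧ ‖x‖ ≤ C * ‖y‖ := by
  have : CompleteSpace A.graph := (show IsClosed (A.graph : Set (X × X)) from hA).completeSpace_coe
  have : CompleteSpace (range (subScalar A μ)) := hR.completeSpace_coe
  let f₀ : X × X →L[ℂ] X :=
    ContinuousLinearMap.snd ℂ X X - μ • ContinuousLinearMap.fst ℂ X X
  let f : A.graph →L[ℂ] range (subScalar A μ) :=
    (f₀ ∘L A.graph.subtypeL).codRestrict (range (subScalar A μ)) fun p =>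
      mem_range_subScalar.2 ⟨p.1.1, p.1.2, p.2, by simp [f₀]⟩
  have hf : Function.Surjective f := by
    rintro ⟨y, hy⟩
    obtain ⟨x, z, h, rfl⟩ := mem_range_subScalar.1 hy
    exact ⟨⟨(x, z), h⟩, Subtype.ext (by simp [f, f₀])⟩
  obtain ⟨C, hC, h⟩ := f.exists_preimage_norm_le hf
  refine ⟨C, hC, fun y hy => ?_⟩
  obtain ⟨⟨⟨x, z⟩, hxz⟩, hp, hn⟩ := h ⟨y, hy⟩
  refine ⟨x, z, hxz, ?_, (norm_fst_le (x, z)).trans hn⟩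
  have := congrArg Subtype.val hp
  simpa [f, f₀] using this

/-- For x in D(A), approximate w = (A - μ)x by y - s y, which lies in the range and in D(A ^ n). A
controlled preimage u of the error makes x - u a nearby point of D(A ^ (n + 1)). -/
theorem dense_domain_pow [CompleteSpace X] {A : X →ₗ.[ℂ] X} (hA : A.IsClosed)
    (hdense : Dense (A.domain : Set X)) {μ : ℂ} (hμ : IsFredholm (subScalar A μ)) (n : ℕ) :
    Dense ((pow A n).domain : Set X) := by
  induction n with
  | zero => simp [domain_pow_zero]
  | succ n ih =>
    have := hμ.finite_coker
    obtain ⟨s, hs, hsD, hsR, hs0⟩ := exists_section_of_dense ih hμ.isClosed_range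
    obtain ⟨C, hC, hpre⟩ := exists_preimage_subScalar_norm_le hA hμ.isClosed_range
    rw [dense_iff_closure_eq, ← Set.univ_subset_iff, ← hdense.closure_eq]
    refine closure_minimal (fun x hx => ?_) isClosed_closure
    obtain ⟨z, hxz⟩ := LinearPMap.mem_domain_iff.1 hx
    set w := z - μ • x with hw
    have hwR : w ∈ range (subScalar A μ) := mem_range_subScalar.2 ⟨x, z, hxz, rfl⟩
    rw [Metric.mem_closure_iff]
    intro ε hε
    have hcont : ContinuousAt (fun y => ‖w - (y - s y)‖) w := by fun_prop
    have hlim : ∀ᶠ y in 𝓝 w, ‖w - (y - s y)‖ < ε / C := by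
      refine hcont.eventually_lt_const ?_
      simp only [hs0 w hwR, sub_zero, sub_self, norm_zero]
      positivity
    obtain ⟨y, hyD, hy⟩ := ((mem_closure_iff_frequently.1 (ih w)).and_eventually hlim).exists
    obtain ⟨u, v, huv, hu, hnorm⟩ := hpre (w - (y - s y)) (sub_mem hwR (hsR y))
    refine ⟨x - u, ?_, ?_⟩
    · refine mem_domain_pow_succ_of_sub_smul_mem (μ := μ) (A.graph.sub_mem hxz huv) ?_
      have : z - v - μ • (x - u) = y - s y := by
        rw [smul_sub, sub_sub_sub_comm, hu, ← hw]; abel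
      rw [this]
      exact sub_mem hyD (hsD y)
    · rw [dist_eq_norm, sub_sub_cancel]
      calc ‖u‖ ≤ C * ‖w - (y - s y)‖ := hnorm
        _ < C * (ε / C) := by gcongr
        _ = ε := by field_simp

/-- Write x in D(A ^ n) as (A - μ)u + s with s in D(A ^ (n + 1)). Then u lies in D(A ^ (n + 1)) =
D(A ^ (n + 2)), so (A - μ)u, hence x, is in D(A ^ (n + 1)). -/
theorem domain_pow_succ_eq_of_succ [CompleteSpace X] {A : X →ₗ.[ℂ] X} (hA : A.IsClosed)
    (hdense : Dense (A.domain : Set X)) {μ : ℂ} (hμ : IsFredholm (subScalar A μ)) {n : ℕ}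
    (h : (pow A (n + 2)).domain = (pow A (n + 1)).domain) :
    (pow A (n + 1)).domain = (pow A n).domain := by
  refine le_antisymm (domain_pow_succ_le A n) fun x hx => ?_
  have := hμ.finite_coker
  obtain ⟨s, -, hsD, hsR, -⟩ :=
    exists_section_of_dense (dense_domain_pow hA hdense hμ (n + 1)) hμ.isClosed_range
  obtain ⟨u, v, huv, hu⟩ := mem_range_subScalar.1 (hsR x)
  have hmem : x - s x ∈ (pow A n).domain := sub_mem hx (domain_pow_succ_le A n (hsD x))
  have hu₁ : u ∈ (pow A (n + 1)).domain :=
    mem_domain_pow_succ_of_sub_smul_mem huv (by rwa [hu])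
  obtain ⟨v', huv', hv'⟩ := mem_domain_pow_succ.1 (h ▸ hu₁)
  obtain rfl : v = v' := A.mem_graph_snd_inj huv huv' rfl
  have := add_mem (sub_mem hv' (Submodule.smul_mem _ μ hu₁)) (hsD x)
  rwa [hu, sub_add_cancel] at this

/-- A closed densely defined operator with non-empty essential resolvent set, for which the domains
of the powers stabilize, is everywhere defined. -/
theorem domain_eq_top [CompleteSpace X] {A : X →ₗ.[ℂ] X} (hA : A.IsClosed)
    (hdense : Dense (A.domain : Set X)) (hess : (essentialResolvent A).Nonempty)
    (hdom : ∀ᶠ j : ℕ in atTop, (pow A (j + 1)).domain = (pow A j).domain) :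
    A.domain = ⊤ := by
  obtain ⟨μ, hμ⟩ := hess
  have hμ : IsFredholm (subScalar A μ) := not_not.1 hμ
  obtain ⟨n, hn⟩ := hdom.exists
  rw [← domain_pow_one, ← domain_pow_zero A]
  induction n with
  | zero => exact hn
  | succ n ih => exact ih (domain_pow_succ_eq_of_succ hA hdense hμ hn)

end Domains

/-! ### Bounded operators as everywhere defined partial operators. -/

section Total

variable {X : Type*} [NormedAddCommGroup X] [NormedSpace ℂ X]

/-- A bounded operator as an everywhere defined operator. -/
abbrev total (T : X →L[ℂ] X) : X →ₗ.[ℂ] X :=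
  (T : X →ₗ[ℂ] X).toPMap ⊤

theorem exists_eq_total [CompleteSpace X] {A : X →ₗ.[ℂ] X} (hA : A.IsClosed)
    (h : A.domain = ⊤) : ∃ T : X →L[ℂ] X, A = total T := by
  let f : X →ₗ[ℂ] X := A.toFun ∘ₗ (LinearMap.id.codRestrict A.domain fun x => h ▸ trivial)
  have hf : f.toPMap ⊤ = A := LinearPMap.ext h.symm fun x _ _ => rfl
  have hgraph : (f.graph : Set (X × X)) = A.graph := by
    ext ⟨x, y⟩
    rw [← hf]
    simp [LinearMap.mem_graph_iff, LinearPMap.mem_graph_iff, eq_comm]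
  exact ⟨⟨f, f.continuous_of_isClosed_graph (hgraph ▸ hA)⟩, hf.symm⟩

theorem range_total (T : X →L[ℂ] X) : range (total T) = (T : X →ₗ[ℂ] X).range := by
  ext y
  exact ⟨fun ⟨x, hx⟩ => ⟨x, hx⟩, fun ⟨x, hx⟩ => ⟨⟨x, trivial⟩, hx⟩⟩

theorem nullSpace_total (T : X →L[ℂ] X) : nullSpace (total T) = (T : X →ₗ[ℂ] X).ker := by
  ext y
  exact ⟨fun ⟨x, hx, hxy⟩ => hxy ▸ hx, fun hy => ⟨⟨y, trivial⟩, hy, rfl⟩⟩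

theorem subScalar_total (T : X →L[ℂ] X) (μ : ℂ) :
    subScalar (total T) μ = total (T - μ • 1) := by
  exact LinearPMap.ext rfl fun x _ _ => subScalar_apply (total T) μ ⟨x, trivial⟩

theorem pow_total (T : X →L[ℂ] X) (n : ℕ) : pow (total T) n = total (T ^ n) := by
  refine LinearPMap.eq_of_eq_graph ?_
  induction n with
  | zero => ext ⟨x, y⟩; simp [pow]
  | succ n ih =>
    ext ⟨x, y⟩
    rw [mem_graph_pow_succ, ih]
    simp [pow_succ']

end Total

/-! ### Fredholm limits of invertible shifts are Browder. -/

section Index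

variable {X : Type*} [NormedAddCommGroup X] [NormedSpace ℂ X]

theorem isFredholm_total {T : X →L[ℂ] X} :
    IsFredholm (total T) ↔ IsClosed (T.range : Set X) ∧ FiniteDimensional ℂ T.ker ∧
      FiniteDimensional ℂ (X ⧸ T.range) := by
  constructor
  · rintro ⟨h₁, h₂, h₃⟩
    rw [range_total] at h₁ h₃
    rw [nullSpace_total] at h₂
    exact ⟨h₁, h₂, h₃⟩
  · rintro ⟨h₁, h₂, h₃⟩
    rw [← range_total] at h₁ h₃
    rw [← nullSpace_total] at h₂
    exact ⟨h₁, h₂, h₃⟩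

/-- A bounded Fredholm operator which is a limit of invertible operators `T - μ` has index zero. -/
theorem finrank_ker_eq_finrank_coker [CompleteSpace X] {T : X →L[ℂ] X}
    [FiniteDimensional ℂ T.ker] [FiniteDimensional ℂ (X ⧸ T.range)]
    (h : (0 : ℂ) ∈ closure {μ | IsUnit (T - μ • 1)}) :
    Module.finrank ℂ T.ker = Module.finrank ℂ (X ⧸ T.range) := by
  obtain ⟨M, hM, hKM⟩ :=
    (Submodule.ClosedComplemented.of_finiteDimensional T.ker).exists_isClosed_isCompl
  have : CompleteSpace M := hM.completeSpace_coe
  obtain ⟨C, hC⟩ := Submodule.exists_isCompl T.range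
  have : FiniteDimensional ℂ C := (Submodule.quotientEquivOfIsCompl _ _ hC).finiteDimensional
  let f : M →L[ℂ] X := T ∘L M.subtypeL
  have hfk : f.ker = ⊥ := by
    refine (Submodule.eq_bot_iff _).2 fun m hm => ?_
    exact Subtype.ext ((Submodule.mem_bot ℂ).1 (hKM.disjoint.le_bot ⟨hm, m.2⟩))
  have hfr : f.range = T.range := by
    refine le_antisymm (fun y ⟨x, hx⟩ => ⟨x, hx⟩) fun y ⟨x, hx⟩ => ?_
    obtain ⟨k, hk, m, hm, rfl⟩ := Submodule.mem_sup.1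
      (hKM.sup_eq_top ▸ trivial : x ∈ T.ker ⊔ M)
    refine ⟨⟨m, hm⟩, ?_⟩
    have hk : T k = 0 := hk
    rw [← hx]
    simp [f, hk]
  let e := f.coprodSubtypeLEquivOfIsCompl (hfr ▸ hC) hfk
  -- Bordering `T - μ` by C gives (m, c) ↦ (T - μ)m + c, an isomorphism at μ = 0 and so for all
  -- small μ.
  let g : ℂ → (M × C →L[ℂ] X) := fun μ => ((T - μ • 1) ∘L M.subtypeL).coprod C.subtypeL
  have hg : Continuous g := by
    have : g = fun μ => (e : M × C →L[ℂ] X) -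
        μ • (M.subtypeL ∘L ContinuousLinearMap.fst ℂ M C) := by
      funext μ
      ext p <;> simp [g, e, f, ContinuousLinearMap.coprodSubtypeLEquivOfIsCompl]
    rw [this]
    fun_prop
  have hg0 : g 0 = e := by
    ext p <;> simp [g, e, f, ContinuousLinearMap.coprodSubtypeLEquivOfIsCompl]
  have hev : ∀ᶠ μ in 𝓝 (0 : ℂ), g μ ∈ Set.range ((↑) : ((M × C) ≃L[ℂ] X) → M × C →L[ℂ] X) :=
    hg.continuousAt.eventually_mem (hg0 ▸ e.nhds)
  obtain ⟨μ, hμ, e', he'⟩ := ((mem_closure_iff_frequently.1 h).and_eventually hev).exists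
  have hge : ∀ (m : M) (c : C), e' (m, c) = (T - μ • 1) m + c := fun m c => by
    have := DFunLike.congr_fun he' (m, c)
    simpa [g] using this
  obtain ⟨V, hV⟩ := hμ
  let U : X →L[ℂ] X := (V⁻¹ : (X →L[ℂ] X)ˣ)
  have hTV : ∀ x, (T - μ • 1) (U x) = x := fun x => by
    rw [← hV]; exact DFunLike.congr_fun V.mul_inv x
  have hVT : ∀ x, U ((T - μ • 1) x) = x := fun x => by
    rw [← hV]; exact DFunLike.congr_fun V.inv_mul x
  -- As X = (T - μ)M ⊕ C, applying U = (T - μ)⁻¹ gives X = M ⊕ U(C). Thus C and ker T are both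
  -- isomorphic to X/M.
  let φ : C →ₗ[ℂ] X ⧸ M := M.mkQ ∘ₗ U.toLinearMap ∘ₗ C.subtype
  have hφ : Function.Bijective φ := by
    constructor
    · rw [← LinearMap.ker_eq_bot, Submodule.eq_bot_iff]
      intro c hc
      have hm : U (c : X) ∈ M := (Submodule.Quotient.mk_eq_zero M).1 hc
      have h0 : e' (⟨_, hm⟩, -c) = 0 := by
        rw [hge]; simp only [hTV]; simp
      have := (map_eq_zero_iff e' e'.injective).1 h0
      simpa using congrArg Prod.snd this
    · intro q
      obtain ⟨x, rfl⟩ := M.mkQ_surjective q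
      obtain ⟨⟨m, c⟩, hmc⟩ := e'.surjective ((T - μ • 1) x)
      refine ⟨c, ?_⟩
      have hc : (c : X) = (T - μ • 1) (x - m) := by
        rw [map_sub, ← hmc, hge]; abel
      change M.mkQ (U (c : X)) = M.mkQ x
      rw [hc, hVT, map_sub, sub_eq_self]
      exact (Submodule.Quotient.mk_eq_zero M).2 m.2
  rw [(Submodule.quotientEquivOfIsCompl _ _ hC).finrank_eq,
    (LinearEquiv.ofBijective φ hφ).finrank_eq,
    (Submodule.quotientEquivOfIsCompl _ _ hKM.symm).finrank_eq]

theorem finiteDimensional_ker_pow {T : X →L[ℂ] X} [FiniteDimensional ℂ T.ker] (n : ℕ) :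
    FiniteDimensional ℂ (T ^ n).ker := by
  induction n with
  | zero =>
    have : (T ^ 0).ker = ⊥ := LinearMap.ker_id
    rw [this]; infer_instance
  | succ n ih =>
    let f : (T ^ (n + 1)).ker →ₗ[ℂ] (T ^ n).ker :=
      T.toLinearMap.restrict fun x hx => by
        have : (T ^ (n + 1)) x = 0 := hx
        rwa [pow_succ] at this
    have hinj : FiniteDimensional ℂ f.ker := by
      let g : f.ker →ₗ[ℂ] T.ker :=
        ((T ^ (n + 1)).ker.subtype ∘ₗ f.ker.subtype).codRestrict T.ker fun x =>
          congrArg Subtype.val x.2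
      refine FiniteDimensional.of_injective g fun x y hxy => ?_
      exact Subtype.ext (Subtype.ext (congrArg (fun z : T.ker => (z : X)) hxy))
    have : FiniteDimensional ℂ ((T ^ (n + 1)).ker ⧸ f.ker) :=
      f.quotKerEquivRange.symm.finiteDimensional
    exact Module.Finite.of_submodule_quotient f.ker

/-- `T` is a quotient map onto its closed range, and the saturation S + ker T is closed because ker
T is finite-dimensional. -/
theorem isClosed_map [CompleteSpace X] {T : X →L[ℂ] X} (hR : IsClosed (T.range : Set X))
    [FiniteDimensional ℂ T.ker] {S : Submodule ℂ X} (hS : IsClosed (S : Set X)) :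
    IsClosed (S.map T.toLinearMap : Set X) := by
  have : CompleteSpace T.range := hR.completeSpace_coe
  let g : X →L[ℂ] T.range := T.codRestrict T.range fun x => ⟨x, rfl⟩
  have hg : Function.Surjective g := fun ⟨y, x, hx⟩ => ⟨x, Subtype.ext hx⟩
  have hq : IsQuotientMap g := (g.isOpenMap hg).isQuotientMap g.continuous hg
  have hpre : g ⁻¹' (g '' S) = ((S ⊔ T.ker : Submodule ℂ X) : Set X) := by
    ext x
    simp only [Set.mem_preimage, Set.mem_image, SetLike.mem_coe, Submodule.mem_sup]
    constructor
    · rintro ⟨s, hs, hsx⟩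
      refine ⟨s, hs, x - s, ?_, by abel⟩
      have : T s = T x := congrArg Subtype.val hsx
      change T (x - s) = 0
      rw [map_sub, this, sub_self]
    · rintro ⟨s, hs, k, hk, rfl⟩
      refine ⟨s, hs, Subtype.ext ?_⟩
      have hk : T k = 0 := hk
      change T s = T (s + k)
      rw [map_add, hk, add_zero]
  have hcl : IsClosed (g '' S) := by
    rw [← hq.isClosed_preimage, hpre]
    exact S.isClosed_sup_finiteDimensional _ hS
  have := hR.isClosedEmbedding_subtypeVal.isClosedMap _ hcl
  rwa [Set.image_image] at this

theorem range_pow_succ (T : X →L[ℂ] X) (n : ℕ) :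
    (T ^ (n + 1)).range = (T ^ n).range.map T.toLinearMap := by
  rw [← LinearMap.range_comp, pow_succ']
  rfl

theorem isClosed_range_pow [CompleteSpace X] {T : X →L[ℂ] X} (hR : IsClosed (T.range : Set X))
    [FiniteDimensional ℂ T.ker] (n : ℕ) : IsClosed ((T ^ n).range : Set X) := by
  induction n with
  | zero =>
    have : (T ^ 0).range = ⊤ := LinearMap.range_id
    rw [this]; exact isClosed_univ
  | succ n ih =>
    rw [range_pow_succ]
    exact isClosed_map hR ih

theorem exists_rightInverse [CompleteSpace X] {f : X →L[ℂ] X} (hf : Function.Surjective f)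
    [FiniteDimensional ℂ f.ker] : ∃ S : X →L[ℂ] X, f * S = 1 := by
  obtain ⟨M, hM, hKM⟩ :=
    (Submodule.ClosedComplemented.of_finiteDimensional f.ker).exists_isClosed_isCompl
  have : CompleteSpace M := hM.completeSpace_coe
  let g : M →L[ℂ] X := f ∘L M.subtypeL
  have hgk : g.ker = ⊥ := by
    refine (Submodule.eq_bot_iff _).2 fun m hm => ?_
    exact Subtype.ext ((Submodule.mem_bot ℂ).1 (hKM.disjoint.le_bot ⟨hm, m.2⟩))
  have hgr : g.range = ⊤ := by
    refine eq_top_iff.2 fun y _ => ?_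
    obtain ⟨x, hx⟩ := hf y
    obtain ⟨k, hk, m, hm, rfl⟩ := Submodule.mem_sup.1
      (hKM.sup_eq_top ▸ trivial : x ∈ f.ker ⊔ M)
    refine ⟨⟨m, hm⟩, ?_⟩
    have hk : f k = 0 := hk
    rw [← hx]
    simp [g, hk]
  let e := ContinuousLinearEquiv.ofBijective g hgk hgr
  refine ⟨M.subtypeL ∘L (e.symm : X →L[ℂ] M), ?_⟩
  ext y
  exact e.apply_symm_apply y

/-- A surjective operator with a nontrivial finite-dimensional kernel stays non-injective under
small scalar perturbations. -/
theorem eventually_exists_ker_ne_zero [CompleteSpace X] {f : X →L[ℂ] X} (hf : Function.Surjective f)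
    [FiniteDimensional ℂ f.ker] {x : X} (hx : x ≠ 0) (hfx : f x = 0) :
    ∀ᶠ μ in 𝓝 (0 : ℂ), ∃ y ≠ 0, f y = μ • y := by
  obtain ⟨S, hS⟩ := exists_rightInverse hf
  have hcont : Continuous fun μ : ℂ => 1 - μ • S := by fun_prop
  have hu : ∀ᶠ μ in 𝓝 (0 : ℂ), IsUnit (1 - μ • S) :=
    hcont.continuousAt.eventually_mem (Units.isOpen.mem_nhds (by simp))
  filter_upwards [hu] with μ ⟨V, hV⟩
  -- The eigenvector is y = (1 - μS)⁻¹x: applying f to y - μSy = x gives f y = μy.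
  let U : X →L[ℂ] X := (V⁻¹ : (X →L[ℂ] X)ˣ)
  have hVx : (1 - μ • S) (U x) = x := by
    rw [← hV]; exact DFunLike.congr_fun V.mul_inv x
  refine ⟨U x, fun h0 => hx ?_, ?_⟩
  · rw [← hVx, h0, map_zero]
  · have := congrArg f hVx
    rw [hfx] at this
    have hfS : ∀ z, f (S z) = z := fun z => DFunLike.congr_fun hS z
    simpa [hfS, sub_eq_zero] using this

/-- With infinite ascent, T maps Y = ⋂ R(T ^ m) onto itself with nonzero kernel there. All small μ
are then eigenvalues, contradicting invertible shifts arbitrarily near 0. -/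
theorem exists_ker_pow_eq [CompleteSpace X] {T : X →L[ℂ] X} (hR : IsClosed (T.range : Set X))
    [FiniteDimensional ℂ T.ker] (h : (0 : ℂ) ∈ closure {μ | IsUnit (T - μ • 1)}) :
    ∃ n : ℕ, (T ^ n).ker = (T ^ (n + 1)).ker := by
  by_contra! hne
  -- The decreasing subspaces ker T ∩ R(T ^ n) of the finite-dimensional ker T stabilize.
  let E : ℕ →o (Submodule ℂ T.ker)ᵒᵈ :=
    { toFun := fun n => OrderDual.toDual ((T ^ n).range.comap T.ker.subtype)
      monotone' := monotone_nat_of_le_succ fun n x hx => by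
        obtain ⟨y, hy⟩ := hx
        refine ⟨T y, ?_⟩
        rw [← hy, pow_succ]
        rfl }
  obtain ⟨n, hn⟩ := IsArtinian.monotone_stabilizes E
  have hE : ∀ x, T x = 0 → x ∈ (T ^ n).range → ∀ m, x ∈ (T ^ m).range := by
    intro x hx hxn m
    have h₁ : (⟨x, hx⟩ : T.ker) ∈ OrderDual.ofDual (E n) := hxn
    rcases le_total n m with hnm | hmn
    · rw [hn m hnm] at h₁
      exact h₁
    · exact (E.monotone hmn : OrderDual.ofDual (E n) ≤ OrderDual.ofDual (E m)) h₁
  let Y : Submodule ℂ X := ⨅ m, (T ^ m).range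
  have hY : ∀ {x}, x ∈ Y ↔ ∀ m, x ∈ (T ^ m).range := by
    intro x; exact Submodule.mem_iInf _
  have hYc : IsClosed (Y : Set X) := by
    rw [Submodule.coe_iInf]
    exact isClosed_iInter fun m => isClosed_range_pow hR m
  have : CompleteSpace Y := hYc.completeSpace_coe
  have hTY : ∀ x ∈ Y, T x ∈ Y := by
    intro x hx
    rw [hY] at hx ⊢
    intro m
    obtain ⟨y, hy⟩ := hx m
    refine ⟨T y, ?_⟩
    rw [← hy]
    exact DFunLike.congr_fun ((Commute.refl T).pow_left m).eq y
  let f : Y →L[ℂ] Y := T.restrict hTY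
  have hf : Function.Surjective f := by
    rintro ⟨y, hy⟩
    rw [hY] at hy
    have hpre : ∀ m, ∃ x ∈ (T ^ m).range, T x = y := fun m => by
      have := hy (m + 1)
      rw [range_pow_succ] at this
      exact this
    obtain ⟨x, hx, hxy⟩ := hpre n
    refine ⟨⟨x, hY.2 fun m => ?_⟩, Subtype.ext hxy⟩
    -- The preimages x and x' differ by an element of ker T ∩ R(T ^ n), which lies in every range.
    obtain ⟨x', hx', hxy'⟩ := hpre (max n m)
    have hanti : ∀ {a b}, a ≤ b → (T ^ b).range ≤ (T ^ a).range := by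
      intro a b hab z ⟨w, hw⟩
      refine ⟨(T ^ (b - a)) w, ?_⟩
      rw [← hw, ← Nat.add_sub_cancel' hab, pow_add, Nat.add_sub_cancel_left]
      rfl
    have hd := hE (x - x') (by rw [map_sub, hxy, hxy', sub_self])
      (sub_mem hx (hanti (le_max_left n m) hx')) m
    have := add_mem hd (hanti (le_max_right n m) hx')
    rwa [sub_add_cancel] at this
  have : FiniteDimensional ℂ f.ker := by
    let g : f.ker →ₗ[ℂ] T.ker :=
      (Y.subtype ∘ₗ f.ker.subtype).codRestrict T.ker fun x => congrArg Subtype.val x.2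
    exact FiniteDimensional.of_injective g fun x y hxy =>
      Subtype.ext (Subtype.ext (congrArg (fun z : T.ker => (z : X)) hxy))
  obtain ⟨x, hx0, hx⟩ : ∃ x : Y, x ≠ 0 ∧ f x = 0 := by
    have hlt : ¬ (T ^ (n + 1)).ker ≤ (T ^ n).ker := fun hle =>
      hne n (le_antisymm (fun x hx => by
        have hx : (T ^ n) x = 0 := hx
        change (T ^ (n + 1)) x = 0
        rw [pow_succ']
        change T ((T ^ n) x) = 0
        rw [hx, map_zero]) hle)
    obtain ⟨z, hz, hzn⟩ := SetLike.not_le_iff_exists.1 hlt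
    have hz : (T ^ (n + 1)) z = 0 := hz
    rw [pow_succ'] at hz
    exact ⟨⟨(T ^ n) z, hY.2 (hE _ hz ⟨z, rfl⟩)⟩, fun h0 => hzn (congrArg Subtype.val h0),
      Subtype.ext hz⟩
  obtain ⟨μ, hμ, y, hy0, hy⟩ := ((mem_closure_iff_frequently.1 h).and_eventually
    (eventually_exists_ker_ne_zero hf hx0 hx)).exists
  have hinj := (ContinuousLinearMap.isUnit_iff_bijective.1 hμ).1
  have hTy : T (y : X) = μ • (y : X) := congrArg Subtype.val hy
  refine hy0 (Subtype.ext ((map_eq_zero_iff (T - μ • (1 : X →L[ℂ] X)) hinj).1 ?_))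
  simp [hTy]

/-- For an operator of index zero, finite ascent implies finite descent. -/
theorem range_pow_eq_of_ker_pow_eq {T : X →L[ℂ] X} [FiniteDimensional ℂ T.ker]
    [FiniteDimensional ℂ (X ⧸ T.range)]
    (hind : Module.finrank ℂ T.ker = Module.finrank ℂ (X ⧸ T.range)) {n : ℕ}
    (hn : (T ^ n).ker = (T ^ (n + 1)).ker) (hpos : T.ker ≤ (T ^ n).ker) :
    (T ^ n).range = (T ^ (n + 1)).range := by
  have := finiteDimensional_ker_pow (T := T) n
  let K := (T ^ n).ker
  have hTK : ∀ x ∈ K, T x ∈ K := fun x hx => by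
    have hx : (T ^ (n + 1)) x = 0 := (hn ▸ hx : x ∈ (T ^ (n + 1)).ker)
    rwa [pow_succ] at hx
  let t : K →ₗ[ℂ] K := T.toLinearMap.restrict hTK
  let φ : K →ₗ[ℂ] X ⧸ T.range := T.range.mkQ ∘ₗ K.subtype
  have hker : φ.ker = t.range := by
    ext x
    constructor
    · intro hx
      obtain ⟨y, hy⟩ := (Submodule.Quotient.mk_eq_zero T.range).1 hx
      have hyK : y ∈ K := by
        change y ∈ (T ^ n).ker
        rw [hn]
        have hx : (T ^ n) (x : X) = 0 := x.2
        change (T ^ (n + 1)) y = 0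
        rw [pow_succ]
        change (T ^ n) (T y) = 0
        rwa [show T y = x from hy]
      exact ⟨⟨y, hyK⟩, Subtype.ext hy⟩
    · rintro ⟨y, rfl⟩
      exact (Submodule.Quotient.mk_eq_zero T.range).2 ⟨y, rfl⟩
  have htk : Module.finrank ℂ t.ker = Module.finrank ℂ T.ker := by
    have : t.ker.map K.subtype = T.ker := by
      ext x
      constructor
      · rintro ⟨y, hy, rfl⟩
        exact congrArg Subtype.val hy
      · intro hx
        exact ⟨⟨x, hpos hx⟩, Subtype.ext hx, rfl⟩
    rw [← this]
    exact (Submodule.equivMapOfInjective _ K.injective_subtype _).finrank_eq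
  -- Since ker φ = T K, rank φ = dim K - dim T K = dim ker T = codim R(T). Thus X = K + R(T), and
  -- applying T ^ n kills K.
  have hφ : φ.range = ⊤ := by
    apply Submodule.eq_top_of_finrank_eq
    have h₁ := φ.finrank_range_add_finrank_ker
    have h₂ := t.finrank_range_add_finrank_ker
    rw [hker] at h₁
    omega
  refine le_antisymm ?_ ?_
  · rintro _ ⟨x, rfl⟩
    obtain ⟨k, hk⟩ := (hφ ▸ trivial : T.range.mkQ x ∈ φ.range)
    obtain ⟨y, hy⟩ := (Submodule.Quotient.eq T.range).1 hk
    have hk0 : (T ^ n) (k : X) = 0 := k.2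
    refine ⟨-y, ?_⟩
    have hy : T y = k - x := hy
    change (T ^ (n + 1)) (-y) = (T ^ n) x
    rw [pow_succ]
    change (T ^ n) (T (-y)) = _
    rw [map_neg, hy, neg_sub, map_sub, hk0, sub_zero]
  · rintro _ ⟨x, rfl⟩
    exact ⟨T x, by rw [pow_succ]; rfl⟩

theorem isBrowder_total_of_mem_closure [CompleteSpace X] {T : X →L[ℂ] X} (hT : IsFredholm (total T))
    (h : (0 : ℂ) ∈ closure {μ | IsUnit (T - μ • 1)}) : IsBrowder (total T) := by
  obtain ⟨hR, _, _⟩ := isFredholm_total.1 hT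
  obtain ⟨n, hn⟩ := exists_ker_pow_eq hR h
  have hind := finrank_ker_eq_finrank_coker h
  refine ⟨hT, ⟨n, ?_⟩, ⟨n, ?_⟩⟩
  · rw [pow_total, pow_total, nullSpace_total, nullSpace_total]
    exact hn
  · rw [pow_total, pow_total, range_total, range_total]
    refine range_pow_eq_of_ker_pow_eq hind hn fun x hx => ?_
    rw [hn]
    change (T ^ (n + 1)) x = 0
    rw [pow_succ]
    change (T ^ n) (T x) = 0
    rw [show T x = 0 from hx, map_zero]

end Index

/-! ### Idempotents and units in rings. -/

section Algebra

variable {R : Type*} [Ring R]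

theorem isUnit_mul_add_one_sub {u e : R} (hu : IsUnit u) (he : e * e = e) (h : Commute u e) :
    IsUnit (u * e + (1 - e)) := by
  obtain ⟨u, rfl⟩ := hu
  have h' : Commute (↑u⁻¹ : R) e := h.units_inv_left
  refine ⟨⟨u * e + (1 - e), ↑u⁻¹ * e + (1 - e), ?_, ?_⟩, rfl⟩
  · have h₁ : (u : R) * e * (↑u⁻¹ * e) = e := by
      rw [mul_assoc, ← mul_assoc e, ← h'.eq, mul_assoc, he, ← mul_assoc, u.mul_inv, one_mul]
    have h₂ : (u : R) * e * (1 - e) = 0 := by rw [mul_assoc, mul_sub, mul_one, he, sub_self, mul_zero]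
    have h₃ : (1 - e) * (↑u⁻¹ * e) = 0 := by
      rw [h'.eq, ← mul_assoc, sub_mul, one_mul, he, sub_self, zero_mul]
    have h₄ : (1 - e) * (1 - e) = 1 - e := by
      rw [mul_sub, mul_one, sub_mul, one_mul, he, sub_self, sub_zero]
    rw [add_mul, mul_add, mul_add, h₁, h₂, h₃, h₄]
    abel
  · have h₁ : (↑u⁻¹ : R) * e * (u * e) = e := by
      rw [mul_assoc, ← mul_assoc e, ← h.eq, mul_assoc, he, ← mul_assoc, u.inv_mul, one_mul]
    have h₂ : (↑u⁻¹ : R) * e * (1 - e) = 0 := by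
      rw [mul_assoc, mul_sub, mul_one, he, sub_self, mul_zero]
    have h₃ : (1 - e) * (u * e) = 0 := by
      rw [h.eq, ← mul_assoc, sub_mul, one_mul, he, sub_self, zero_mul]
    have h₄ : (1 - e) * (1 - e) = 1 - e := by
      rw [mul_sub, mul_one, sub_mul, one_mul, he, sub_self, sub_zero]
    rw [add_mul, mul_add, mul_add, h₁, h₂, h₃, h₄]
    abel

/-- In block form relative to e, t is v on one corner and u on the other. -/
theorem isUnit_of_mul_idempotent {t u v e : R} (he : e * e = e) (hu : IsUnit u) (hv : IsUnit v)
    (hue : Commute u e) (hve : Commute v e) (hte : t * e = v * e) (hte' : t * (1 - e) = u * (1 - e)) :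
    IsUnit t := by
  have h₁ := isUnit_mul_add_one_sub hv he hve
  have he' : (1 - e) * (1 - e) = 1 - e := by
    rw [mul_sub, mul_one, sub_mul, one_mul, he, sub_self, sub_zero]
  have h₂ := isUnit_mul_add_one_sub hu he' ((Commute.one_right u).sub_right hue)
  rw [sub_sub_cancel] at h₂
  have : t = (u * (1 - e) + e) * (v * e + (1 - e)) := by
    have a₁ : u * (1 - e) * (v * e) = 0 := by
      rw [hve.eq, mul_assoc, ← mul_assoc (1 - e), sub_mul, one_mul, he, sub_self, zero_mul,
        mul_zero]
    have a₂ : e * (v * e) = v * e := by rw [hve.eq, ← mul_assoc, he]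
    have a₃ : e * (1 - e) = 0 := by rw [mul_sub, mul_one, he, sub_self]
    rw [add_mul, mul_add, mul_add, a₁, a₂, a₃, mul_assoc, he', ← hte, ← hte', zero_add, add_zero,
      ← mul_add, sub_add_cancel, mul_one]
  rw [this]
  exact h₂.mul h₁

/-- The factorization of `t - μ` through `t (1 - t b) - μ`, for `b` an outer inverse of `t`
commuting with it. -/
theorem exists_isUnit_sub_eq_mul {𝕜 A : Type*} [Field 𝕜] [Ring A] [Algebra 𝕜 A] {t b : A} {μ : 𝕜}
    (hμ : μ ≠ 0) (hc : Commute t b) (hb : b * t * b = b) (hu : IsUnit (1 - μ • b)) :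
    ∃ w, IsUnit w ∧ t - μ • 1 = (t * (1 - t * b) - μ • 1) * w := by
  set q := t * b with hq
  have hqq : q * q = q := by
    rw [hq, mul_assoc, ← mul_assoc b, hb]
  have hqt : Commute t q := (Commute.refl t).mul_right hc
  have hqb : q * b = b := by rw [hq, hc.eq, hb]
  have hbq : b * q = b := by rw [hq, ← mul_assoc, hb]
  have hμu : IsUnit (algebraMap 𝕜 A (-μ⁻¹)) :=
    (Ne.isUnit (neg_ne_zero.2 (inv_ne_zero hμ))).map (algebraMap 𝕜 A)
  -- On the corner of q, b is the inverse of t.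
  have hV : IsUnit (t * q + (1 - q)) := by
    refine ⟨⟨_, b + (1 - q), ?_, ?_⟩, rfl⟩
    · have h₁ : t * q * b = q := by rw [mul_assoc, hqb]
      have h₂ : t * q * (1 - q) = 0 := by rw [mul_assoc, mul_sub, mul_one, hqq, sub_self, mul_zero]
      have h₃ : (1 - q) * b = 0 := by rw [sub_mul, one_mul, hqb, sub_self]
      have h₄ : (1 - q) * (1 - q) = 1 - q := by
        rw [mul_sub, mul_one, sub_mul, one_mul, hqq, sub_self, sub_zero]
      rw [add_mul, mul_add, mul_add, h₁, h₂, h₃, h₄]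
      abel
    · have h₁ : b * (t * q) = q := by rw [← mul_assoc, ← hc.eq, ← hq, hqq]
      have h₂ : (1 - q) * (t * q) = 0 := by
        rw [hqt.eq, ← mul_assoc, sub_mul, one_mul, hqq, sub_self, zero_mul]
      have h₃ : b * (1 - q) = 0 := by rw [mul_sub, mul_one, hbq, sub_self]
      have h₄ : (1 - q) * (1 - q) = 1 - q := by
        rw [mul_sub, mul_one, sub_mul, one_mul, hqq, sub_self, sub_zero]
      rw [add_mul, mul_add, mul_add, h₁, h₂, h₃, h₄]
      abel
  have hW : IsUnit ((t - μ • 1) * q + (1 - q)) := by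
    have : (t - μ • 1) * q + (1 - q) = (t * q + (1 - q)) * (1 - μ • b) := by
      have h₁ : t * q * b = q := by rw [mul_assoc, hqb]
      have h₃ : (1 - q) * b = 0 := by rw [sub_mul, one_mul, hqb, sub_self]
      rw [mul_sub, mul_one, mul_smul_comm, add_mul _ _ b, h₁, h₃, sub_mul, smul_mul_assoc, one_mul]
      simp only [add_zero]
      abel
    rw [this]
    exact hV.mul hu
  have hS : IsUnit (algebraMap 𝕜 A (-μ⁻¹) * q + (1 - q)) :=
    isUnit_mul_add_one_sub hμu hqq (Algebra.commute_algebraMap_left _ _)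
  -- On the q corner t(1 - q) - μ is just -μ, so w must be -μ⁻¹(t - μ) there; on the other corner w
  -- = 1.
  refine ⟨_, hW.mul hS, ?_⟩
  have key : ((t - μ • 1) * q + (1 - q)) * (algebraMap 𝕜 A (-μ⁻¹) * q + (1 - q)) =
      (-μ⁻¹) • ((t - μ • 1) * q) + (1 - q) := by
    have h₂ : (t - μ • 1) * q * (1 - q) = 0 := by
      rw [mul_assoc, mul_sub, mul_one, hqq, sub_self, mul_zero]
    have h₃ : (1 - q) * q = 0 := by rw [sub_mul, one_mul, hqq, sub_self]
    have h₄ : (1 - q) * (1 - q) = 1 - q := by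
      rw [mul_sub, mul_one, h₃, sub_zero]
    rw [← Algebra.smul_def, mul_add, add_mul, add_mul, h₂, h₄, mul_smul_comm, mul_smul_comm, h₃,
      mul_assoc, hqq, smul_zero, add_zero, zero_add]
  rw [key]
  have e₁ : (t * (1 - q) - μ • 1) * ((t - μ • 1) * q) = -(μ • ((t - μ • 1) * q)) := by
    have : Commute ((t - μ • 1 : A)) q :=
      hqt.sub_left ((Commute.one_left q).smul_left μ)
    rw [this.eq, ← mul_assoc, sub_mul (t * (1 - q)), mul_assoc t, sub_mul 1, one_mul, hqq, sub_self,
      mul_zero, zero_sub, smul_mul_assoc, one_mul, neg_mul, smul_mul_assoc]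
  have e₂ : (t * (1 - q) - μ • 1) * (1 - q) = (t - μ • 1) * (1 - q) := by
    have h₄ : (1 - q) * (1 - q) = 1 - q := by
      rw [mul_sub, mul_one, sub_mul, one_mul, hqq, sub_self, sub_zero]
    rw [sub_mul, sub_mul t, mul_assoc, h₄]
  rw [mul_add, mul_smul_comm, e₁, e₂, smul_neg, neg_smul, neg_neg, smul_smul, inv_mul_cancel₀ hμ,
    one_smul, ← mul_add, add_sub_cancel, mul_one]

end Algebra

/-! ### Splitting of Browder operators. -/

section Browder

variable {X : Type*} [NormedAddCommGroup X] [NormedSpace ℂ X]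

theorem ker_pow_eq_of_le {T : X →L[ℂ] X} {n m : ℕ} (h : (T ^ n).ker = (T ^ (n + 1)).ker)
    (hm : n ≤ m) : (T ^ m).ker = (T ^ (m + 1)).ker := by
  induction m, hm using Nat.le_induction with
  | base => exact h
  | succ m _ ih =>
    ext x
    have : T x ∈ (T ^ m).ker ↔ T x ∈ (T ^ (m + 1)).ker := by rw [ih]
    rw [pow_succ T m, pow_succ T (m + 1)]
    exact this

theorem range_pow_eq_of_le {T : X →L[ℂ] X} {n m : ℕ} (h : (T ^ n).range = (T ^ (n + 1)).range)
    (hm : n ≤ m) : (T ^ m).range = (T ^ (m + 1)).range := by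
  induction m, hm using Nat.le_induction with
  | base => exact h
  | succ m _ ih => rw [range_pow_succ, ih, ← range_pow_succ]

/-- A Browder operator splits into a nilpotent operator on a finite-dimensional space and an
invertible one. -/
theorem exists_idempotent_of_isBrowder [CompleteSpace X] {T : X →L[ℂ] X}
    (hT : IsBrowder (total T)) :
    ∃ F : X →L[ℂ] X, F * F = F ∧ Commute T F ∧ FiniteDimensional ℂ F.range ∧
      IsNilpotent (T * F) ∧ IsUnit (T + F) := by
  obtain ⟨hF, ⟨p, hp⟩, ⟨q, hq⟩⟩ := hT
  obtain ⟨hR, _, _⟩ := isFredholm_total.1 hF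
  rw [pow_total, pow_total, nullSpace_total, nullSpace_total] at hp
  rw [pow_total, pow_total, range_total, range_total] at hq
  -- The extra 1 makes m positive, needed for F ^ m = F and for ker T ⊆ ker T ^ m.
  set m := max p q + 1
  have hker : ∀ j, (T ^ (m + j)).ker = (T ^ m).ker := fun j => by
    induction j with
    | zero => rfl
    | succ j ih => rw [← ih, ← add_assoc, ← ker_pow_eq_of_le hp (by omega)]
  have hran : ∀ j, (T ^ (m + j)).range = (T ^ m).range := fun j => by
    induction j with
    | zero => rfl
    | succ j ih => rw [← ih, ← add_assoc, ← range_pow_eq_of_le hq (by omega)]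
  have := finiteDimensional_ker_pow (T := T) m
  have hcompl : IsCompl (T ^ m).ker (T ^ m).range := by
    constructor
    · rw [Submodule.disjoint_def]
      rintro x hx ⟨y, rfl⟩
      have : y ∈ (T ^ (m + m)).ker := by rw [pow_add]; exact hx
      rw [hker] at this
      exact this
    · rw [codisjoint_iff, eq_top_iff]
      intro x _
      obtain ⟨y, hy⟩ := ((hran m).symm ▸ ⟨x, rfl⟩ : (T ^ m) x ∈ (T ^ (m + m)).range)
      refine Submodule.mem_sup.2 ⟨x - (T ^ m) y, ?_, (T ^ m) y, ⟨y, rfl⟩, sub_add_cancel _ _⟩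
      change (T ^ m) (x - (T ^ m) y) = 0
      rw [map_sub, sub_eq_zero, ← hy, pow_add]
      rfl
  have htop : Submodule.IsTopCompl (T ^ m).ker (T ^ m).range :=
    Submodule.IsCompl.isTopCompl_of_isClosed hcompl (Submodule.closed_of_finiteDimensional _)
      (isClosed_range_pow hR m)
  let F : X →L[ℂ] X := (T ^ m).ker.projectionL (T ^ m).range htop
  have hFK : ∀ x, (T ^ m) x = 0 → F x = x := fun x hx =>
    Submodule.projection_apply_of_mem_left hcompl hx
  have hFY : ∀ x, F ((T ^ m) x) = 0 := fun x =>
    (Submodule.projection_apply_eq_zero_iff hcompl).2 ⟨x, rfl⟩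
  have hmem : ∀ x, (T ^ m) (F x) = 0 := fun x => Submodule.projection_apply_mem hcompl x
  have hsub : ∀ x, ∃ y, x - F x = (T ^ m) y := fun x => by
    obtain ⟨y, hy⟩ := Submodule.sub_projection_mem hcompl x
    exact ⟨y, hy.symm⟩
  have hTm : ∀ x, (T ^ m) (T x) = T ((T ^ m) x) := fun x =>
    DFunLike.congr_fun ((Commute.refl T).pow_left m).eq x
  have hFF : F * F = F := ContinuousLinearMap.ext fun x => hFK _ (hmem x)
  have hTF : ∀ x, T (F x) = F (T x) := fun x => by
    obtain ⟨y, hy⟩ := hsub x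
    have h₁ : T x = T (F x) + (T ^ m) (T y) := by rw [hTm, ← hy, map_sub]; abel
    have h₂ : F (T (F x)) = T (F x) := hFK _ (by rw [hTm, hmem, map_zero])
    have h₃ := congrArg F h₁
    rw [map_add, hFY, add_zero, h₂] at h₃
    exact h₃.symm
  have hc : Commute T F := ContinuousLinearMap.ext hTF
  have hnil : IsNilpotent (T * F) := ⟨m, by
    rw [hc.mul_pow]
    ext x
    have : F ^ m = F := by
      change F ^ (max p q + 1) = F
      exact IsIdempotentElem.pow_succ_eq _ hFF
    rw [this]
    exact hmem x⟩
  refine ⟨F, hFF, hc, ?_, hnil, ?_⟩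
  · have : F.range = (T ^ m).ker := Submodule.range_projection hcompl
    rw [this]; infer_instance
  -- T + F is identity plus nilpotent on ker T ^ m, and equals the bijective T on R(T ^ m).
  obtain ⟨V, hV⟩ := hnil.isUnit_one_add
  have hVinj : ∀ x, x + T (F x) = 0 → x = 0 := fun x hx => by
    have h₁ : (↑V⁻¹ * ↑V : X →L[ℂ] X) x = x := by rw [V.inv_mul]; rfl
    rw [hV] at h₁
    rw [← h₁]
    change (↑V⁻¹ : X →L[ℂ] X) (x + T (F x)) = 0
    rw [hx, map_zero]
  have hVsurj : ∀ y, ∃ x, x + T (F x) = y := fun y => by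
    refine ⟨(↑V⁻¹ : X →L[ℂ] X) y, ?_⟩
    have h₁ : (↑V * ↑V⁻¹ : X →L[ℂ] X) y = y := by rw [V.mul_inv]; rfl
    rw [hV] at h₁
    exact h₁
  have hFFx : ∀ x, F (F x) = F x := fun x => DFunLike.congr_fun hFF x
  rw [ContinuousLinearMap.isUnit_iff_bijective]
  constructor
  · rw [injective_iff_map_eq_zero]
    intro x hx
    have hx : T x + F x = 0 := hx
    have hFx : F x = 0 := by
      apply hVinj
      have := congrArg F hx
      rw [map_add, hFFx, ← hTF, map_zero] at this
      rw [hFFx, add_comm, this]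
    have hTx : T x = 0 := by rwa [hFx, add_zero] at hx
    rw [← hFK x ?_, hFx]
    change (T ^ (max p q + 1)) x = 0
    rw [pow_succ]
    change (T ^ max p q) (T x) = 0
    rw [hTx, map_zero]
  · intro y
    obtain ⟨w, hw⟩ := hsub y
    obtain ⟨w', hw'⟩ := ((hran 1).symm ▸ ⟨w, rfl⟩ : (T ^ m) w ∈ (T ^ (m + 1)).range)
    obtain ⟨k, hk⟩ := hVsurj (F y)
    have hw' : T ((T ^ m) w') = (T ^ m) w := by
      rw [← hw']
      exact (DFunLike.congr_fun (pow_succ' T m) w').symm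
    refine ⟨F k + (T ^ m) w', ?_⟩
    change T (F k + (T ^ m) w') + F (F k + (T ^ m) w') = y
    have hk' := congrArg F hk
    rw [map_add, hFFx, ← hTF, hFFx] at hk'
    rw [map_add, map_add, hFFx, hFY, hw', ← hw, add_zero, add_right_comm, add_comm (T (F k)), hk']
    abel

/-- T - μ agrees with nilpotent minus μ on the range of F, and with the unit T + F - μ on its
complement. -/
theorem eventually_isUnit_of_isBrowder [CompleteSpace X] {T : X →L[ℂ] X}
    (hT : IsBrowder (total T)) : ∀ᶠ μ in 𝓝[≠] (0 : ℂ), IsUnit (T - μ • 1) := by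
  obtain ⟨F, hFF, hc, -, hnil, hu⟩ := exists_idempotent_of_isBrowder hT
  have hcont : Continuous fun μ : ℂ => T + F - μ • 1 := by fun_prop
  have hu : ∀ᶠ μ in 𝓝 (0 : ℂ), IsUnit (T + F - μ • 1) :=
    hcont.continuousAt.eventually_mem (Units.isOpen.mem_nhds (by simpa using hu))
  filter_upwards [nhdsWithin_le_nhds hu, self_mem_nhdsWithin] with μ hμ hμ0
  have hμF : Commute (μ • (1 : X →L[ℂ] X)) F := (Commute.one_left F).smul_left μ
  have hV : IsUnit (T * F - μ • 1) := by
    have h1 : IsUnit (μ • (1 : X →L[ℂ] X)) := by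
      rw [← Algebra.algebraMap_eq_smul_one]
      exact (Ne.isUnit hμ0).map (algebraMap ℂ (X →L[ℂ] X))
    have := hnil.isUnit_add_right_of_commute h1.neg
      ((Commute.one_right (T * F)).smul_right μ).neg_right
    rwa [← sub_eq_add_neg] at this
  refine isUnit_of_mul_idempotent hFF hμ hV ((hc.add_left (Commute.refl F)).sub_left hμF)
    ((hc.mul_left (Commute.refl F)).sub_left hμF) ?_ ?_
  · rw [sub_mul, sub_mul, mul_assoc T, hFF]
  · rw [sub_mul, sub_mul, add_mul, mul_sub F, mul_one, hFF, sub_self, add_zero]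

end Browder

/-! ### Laurent coefficients of the resolvent (z - t)⁻¹ on a spectrum-free annulus. -/

section Laurent

variable {𝓐 : Type*} [NormedRing 𝓐] [NormedAlgebra ℂ 𝓐]

theorem mul_resolvent {t : 𝓐} {z : ℂ} (hz : z ∈ resolventSet ℂ t) :
    t * resolvent t z = z • resolvent t z - 1 := by
  have := Ring.mul_inverse_cancel _ hz
  rw [sub_mul, ← Algebra.smul_def] at this
  rw [resolvent, ← this]
  abel

theorem resolvent_mul {t : 𝓐} {z : ℂ} (hz : z ∈ resolventSet ℂ t) :
    resolvent t z * t = z • resolvent t z - 1 := by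
  have := Ring.inverse_mul_cancel _ hz
  rw [mul_sub, ← Algebra.commutes, ← Algebra.smul_def] at this
  rw [resolvent, ← this]
  abel

variable [CompleteSpace 𝓐]

theorem circleIntegral_comp_comm (L : 𝓐 →L[ℂ] 𝓐) {f : ℂ → 𝓐} {c : ℂ} {R : ℝ}
    (hf : CircleIntegrable f c R) : (∮ z in C(c, R), L (f z)) = L (∮ z in C(c, R), f z) := by
  simp only [circleIntegral, ← L.map_smul]
  exact L.intervalIntegral_comp_comm hf.out

/-- The Laurent coefficients of the resolvent of `t` on the circle of radius `s`. -/
noncomputable def laurentCoeff (t : 𝓐) (s : ℝ) (k : ℤ) : 𝓐 :=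
  (2 * Real.pi * Complex.I : ℂ)⁻¹ • ∮ z in C(0, s), z ^ k • resolvent t z

theorem continuousOn_zpow_smul_resolvent {t : 𝓐} {S : Set ℂ} (hS : S ⊆ resolventSet ℂ t)
    (h0 : (0 : ℂ) ∉ S) (k : ℤ) : ContinuousOn (fun z => z ^ k • resolvent t z) S := fun z hz =>
  ((continuousAt_zpow₀ z k (Or.inl fun h => h0 (h ▸ hz))).smul
    (spectrum.hasDerivAt_resolvent_const_left (hS hz)).continuousAt).continuousWithinAt

theorem circleIntegrable_zpow_smul_resolvent {t : 𝓐} {s : ℝ} (hs : 0 < s)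
    (h : Metric.sphere 0 s ⊆ resolventSet ℂ t) (k : ℤ) :
    CircleIntegrable (fun z => z ^ k • resolvent t z) 0 s :=
  (continuousOn_zpow_smul_resolvent h (by simp [hs.ne]) k).circleIntegrable hs.le

/-- Independence of the radius lets one coefficient be bounded by both r ^ k and s ^ k. -/
theorem laurentCoeff_eq {t : 𝓐} {r s : ℝ} (hr : 0 < r) (hrs : r ≤ s)
    (h : ∀ z : ℂ, r ≤ ‖z‖ → ‖z‖ ≤ s → z ∈ resolventSet ℂ t) (k : ℤ) :
    laurentCoeff t s k = laurentCoeff t r k := by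
  have hmem : ∀ z ∈ Metric.closedBall (0 : ℂ) s \ Metric.ball 0 r, z ∈ resolventSet ℂ t :=
    fun z hz => h z (by simpa using hz.2) (by simpa using hz.1)
  have hne : ∀ z ∈ Metric.closedBall (0 : ℂ) s \ Metric.ball 0 r, z ≠ 0 := by
    rintro z hz rfl
    exact hz.2 (by simpa using hr)
  rw [laurentCoeff, laurentCoeff,
    Complex.circleIntegral_eq_of_differentiable_on_annulus_off_countable hr hrs
      Set.countable_empty (continuousOn_zpow_smul_resolvent hmem (fun h0 => hne 0 h0 rfl) k)]
  rintro z ⟨hz, -⟩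
  have hz : z ∈ Metric.closedBall (0 : ℂ) s \ Metric.ball 0 r :=
    ⟨Metric.ball_subset_closedBall hz.1, fun h => hz.2 (Metric.ball_subset_closedBall h)⟩
  exact (differentiableAt_zpow.2 (Or.inl (hne z hz))).smul
    (spectrum.hasDerivAt_resolvent_const_left (hmem z hz)).differentiableAt

theorem exists_norm_laurentCoeff_le {t : 𝓐} {s : ℝ} (hs : 0 < s)
    (h : Metric.sphere 0 s ⊆ resolventSet ℂ t) :
    ∃ C, 0 ≤ C ∧ ∀ k, ‖laurentCoeff t s k‖ ≤ C * s ^ k := by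
  have hc := continuousOn_zpow_smul_resolvent h (by simp [hs.ne]) 0
  obtain ⟨M, hM⟩ := (isCompact_sphere (0 : ℂ) s).exists_bound_of_continuousOn hc
  refine ⟨s * max M 0, by positivity, fun k => ?_⟩
  have := circleIntegral.norm_two_pi_i_inv_smul_integral_le_of_norm_le_const
    (f := fun z => z ^ k • resolvent t z) (c := 0) (C := s ^ k * max M 0) hs.le fun z hz => ?_
  · refine this.trans_eq ?_
    ring
  · have hz' : ‖z‖ = s := by simpa using hz
    have := hM z hz
    rw [zpow_zero, one_smul] at this
    rw [norm_smul, norm_zpow, hz']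
    gcongr
    exact this.trans (le_max_left _ _)

theorem commute_laurentCoeff {t : 𝓐} {s : ℝ} (hs : 0 < s)
    (h : Metric.sphere 0 s ⊆ resolventSet ℂ t) (k : ℤ) : Commute t (laurentCoeff t s k) := by
  have hi := circleIntegrable_zpow_smul_resolvent hs h k
  have h₁ := circleIntegral_comp_comm (ContinuousLinearMap.mul ℂ 𝓐 t) hi
  have h₂ := circleIntegral_comp_comm ((ContinuousLinearMap.mul ℂ 𝓐).flip t) hi
  simp only [ContinuousLinearMap.mul_apply', ContinuousLinearMap.flip_apply] at h₁ h₂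
  rw [commute_iff_eq, laurentCoeff, mul_smul_comm, smul_mul_assoc, ← h₁, ← h₂]
  congr 1
  refine circleIntegral.integral_congr hs.le fun z hz => ?_
  simp only [mul_smul_comm, smul_mul_assoc, mul_resolvent (h hz), resolvent_mul (h hz)]

theorem mul_laurentCoeff {t : 𝓐} {s : ℝ} (hs : 0 < s)
    (h : Metric.sphere 0 s ⊆ resolventSet ℂ t) (k : ℤ) :
    t * laurentCoeff t s k = laurentCoeff t s (k + 1) -
      ((2 * Real.pi * Complex.I : ℂ)⁻¹ * ∮ z in C(0, s), z ^ k) • 1 := by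
  have h₁ := circleIntegral_comp_comm (ContinuousLinearMap.mul ℂ 𝓐 t)
    (circleIntegrable_zpow_smul_resolvent hs h k)
  simp only [ContinuousLinearMap.mul_apply'] at h₁
  have hcz : ContinuousOn (fun z : ℂ => z ^ k • (1 : 𝓐)) (Metric.sphere 0 s) := fun z hz =>
    ((continuousAt_zpow₀ z k (Or.inl (by rintro rfl; simp [hs.ne] at hz))).smul
      continuousAt_const).continuousWithinAt
  rw [laurentCoeff, mul_smul_comm, ← h₁, mul_smul, ← circleIntegral.integral_smul_const,
    laurentCoeff, ← smul_sub, ← circleIntegral.integral_sub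
      (circleIntegrable_zpow_smul_resolvent hs h (k + 1)) (hcz.circleIntegrable hs.le)]
  congr 1
  refine circleIntegral.integral_congr hs.le fun z hz => ?_
  have hz0 : z ≠ 0 := by rintro rfl; simp [hs.ne] at hz
  simp only [mul_smul_comm, mul_resolvent (h hz), smul_sub, smul_smul, zpow_add_one₀ hz0]

theorem mul_laurentCoeff_of_ne {t : 𝓐} {s : ℝ} (hs : 0 < s)
    (h : Metric.sphere 0 s ⊆ resolventSet ℂ t) {k : ℤ} (hk : k ≠ -1) :
    t * laurentCoeff t s k = laurentCoeff t s (k + 1) := by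
  have := circleIntegral.integral_sub_zpow_of_ne hk 0 0 s
  simp only [sub_zero] at this
  rw [mul_laurentCoeff hs h, this, mul_zero, zero_smul, sub_zero]

theorem mul_laurentCoeff_neg_one {t : 𝓐} {s : ℝ} (hs : 0 < s)
    (h : Metric.sphere 0 s ⊆ resolventSet ℂ t) :
    t * laurentCoeff t s (-1) = laurentCoeff t s 0 - 1 := by
  have := circleIntegral.integral_sub_center_inv 0 hs.ne'
  simp only [sub_zero] at this
  rw [mul_laurentCoeff hs h]
  simp only [zpow_neg_one]
  rw [this, inv_mul_cancel₀ Complex.two_pi_I_ne_zero, one_smul]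
  rfl

theorem pow_mul_laurentCoeff_zero {t : 𝓐} {s : ℝ} (hs : 0 < s)
    (h : Metric.sphere 0 s ⊆ resolventSet ℂ t) (n : ℕ) :
    t ^ n * laurentCoeff t s 0 = laurentCoeff t s n := by
  induction n with
  | zero => simp
  | succ n ih =>
    rw [pow_succ', mul_assoc, ih, mul_laurentCoeff_of_ne hs h (by omega)]
    push_cast
    rfl

theorem pow_mul_laurentCoeff_neg {t : 𝓐} {s : ℝ} (hs : 0 < s)
    (h : Metric.sphere 0 s ⊆ resolventSet ℂ t) (j n : ℕ) :
    t ^ n * laurentCoeff t s (-(j + 1 + n : ℤ)) = laurentCoeff t s (-(j + 1 : ℤ)) := by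
  induction n with
  | zero => simp
  | succ n ih =>
    rw [pow_succ, mul_assoc, mul_laurentCoeff_of_ne hs h (by omega), ← ih]
    congr 2
    push_cast
    ring

/-- An element whose resolvent set contains the annulus `r ≤ ‖z‖ ≤ s` has a commuting outer inverse
`b` splitting the spectrum along the annulus. -/
theorem exists_outerInverse_of_annulus {t : 𝓐} {r s : ℝ} (hr : 0 < r) (hrs : r < s)
    (h : ∀ z : ℂ, r ≤ ‖z‖ → ‖z‖ ≤ s → z ∈ resolventSet ℂ t) :
    ∃ b : 𝓐, Commute t b ∧ b * t * b = b ∧ ∃ C : ℝ, ∀ n : ℕ,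
      ‖(t * (1 - t * b)) ^ (n + 1)‖ ≤ C * r ^ (n + 1) ∧ ‖b ^ (n + 1)‖ ≤ C * s⁻¹ ^ (n + 1) := by
  have hs : 0 < s := hr.trans hrs
  have hrS : Metric.sphere 0 r ⊆ resolventSet ℂ t := fun z hz => by
    have hz : ‖z‖ = r := by simpa using hz
    exact h z hz.ge (hz.trans_le hrs.le)
  have hsS : Metric.sphere 0 s ⊆ resolventSet ℂ t := fun z hz => by
    have hz : ‖z‖ = s := by simpa using hz
    exact h z (hrs.le.trans hz.ge) hz.le
  obtain ⟨C₁, hC₁, hb₁⟩ := exists_norm_laurentCoeff_le hr hrS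
  obtain ⟨C₂, hC₂, hb₂⟩ := exists_norm_laurentCoeff_le hs hsS
  set a := laurentCoeff t r with ha
  have hb₂ : ∀ k, ‖a k‖ ≤ C₂ * s ^ k := fun k =>
    (congrArg norm (laurentCoeff_eq hr hrs.le h k)).symm.trans_le (hb₂ k)
  have hcomm := commute_laurentCoeff hr hrS
  -- Moving tⁿ across the product leaves it unchanged but bounds it by a multiple of (r / s)ⁿ, so it
  -- is 0; no resolvent identity is needed.
  have hP : ∀ j : ℕ, a 0 * a (-(j + 1 : ℤ)) = 0 := fun j => by
    have hle : ∀ n : ℕ, ‖a 0 * a (-(j + 1 : ℤ))‖ ≤ C₁ * C₂ * s ^ (-(j + 1 : ℤ)) * (r / s) ^ n := by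
      intro n
      have : a 0 * a (-(j + 1 : ℤ)) = a n * a (-(j + 1 + n : ℤ)) := by
        rw [ha, ← pow_mul_laurentCoeff_neg hr hrS j n, ← pow_mul_laurentCoeff_zero hr hrS n,
          ← mul_assoc, ((hcomm 0).pow_left n).eq]
      rw [this]
      calc ‖a n * a (-(j + 1 + n : ℤ))‖ ≤ ‖a n‖ * ‖a (-(j + 1 + n : ℤ))‖ := norm_mul_le _ _
        _ ≤ (C₁ * r ^ (n : ℤ)) * (C₂ * s ^ (-(j + 1 + n : ℤ))) := by
          gcongr
          · exact hb₁ n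
          · exact hb₂ _
        _ = C₁ * C₂ * s ^ (-(j + 1 : ℤ)) * (r / s) ^ n := by
          rw [neg_add, zpow_add₀ hs.ne', zpow_neg s n, zpow_natCast, zpow_natCast, div_pow]
          ring
    have hlim : Tendsto (fun n : ℕ => C₁ * C₂ * s ^ (-(j + 1 : ℤ)) * (r / s) ^ n) atTop (𝓝 0) := by
      rw [← mul_zero (C₁ * C₂ * s ^ (-(j + 1 : ℤ)))]
      exact (tendsto_pow_atTop_nhds_zero_of_lt_one (by positivity)
        ((div_lt_one hs).2 hrs)).const_mul _
    exact norm_le_zero_iff.1 (ge_of_tendsto' hlim hle)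
  have hta : t * a (-1) = a 0 - 1 := mul_laurentCoeff_neg_one hr hrS
  have hP1 : a 0 * a (-1) = 0 := by simpa using hP 0
  have hPP : a 0 * a 0 = a 0 := by
    have : a 0 * (a 0 - 1) = 0 := by
      rw [← hta, ← mul_assoc, ← (hcomm 0).eq, mul_assoc, hP1, mul_zero]
    rwa [mul_sub, mul_one, sub_eq_zero] at this
  have htb : t * -a (-1) = 1 - a 0 := by rw [mul_neg, hta, neg_sub]
  have hcb : Commute t (-a (-1)) := (hcomm (-1)).neg_right
  have hpow : ∀ n : ℕ, (-a (-1)) ^ (n + 1) = -a (-(n + 1 : ℤ)) := fun n => by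
    induction n with
    | zero => simp
    | succ n ih =>
      have hsucc : t * a (-(n + 1 + 1 : ℤ)) = a (-(n + 1 : ℤ)) := by
        simpa using pow_mul_laurentCoeff_neg hr hrS n 1
      have h0 := hP (n + 1)
      push_cast at h0 ⊢
      rw [pow_succ', ih, ← hsucc, mul_neg, ← mul_assoc, ← hcb.eq, htb, sub_mul, one_mul, h0,
        sub_zero]
  -- `a 0` is the Riesz projection of the inner spectrum; `-a (-1)` inverts t on the complementary
  -- part and vanishes on the inner one.
  refine ⟨-a (-1), hcb, ?_, max C₁ C₂, fun n => ⟨?_, ?_⟩⟩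
  · rw [← hcb.eq, htb, sub_mul, one_mul, mul_neg, hP1, neg_zero, sub_zero]
  · rw [htb, sub_sub_cancel, (hcomm 0).mul_pow, IsIdempotentElem.pow_succ_eq _ hPP,
      pow_mul_laurentCoeff_zero hr hrS, ← zpow_natCast r]
    refine (hb₁ _).trans ?_
    gcongr
    exact le_max_left _ _
  · rw [hpow, norm_neg]
    refine (hb₂ _).trans ?_
    rw [zpow_neg, inv_pow, ← zpow_natCast s]
    push_cast
    gcongr
    exact le_max_right _ _

/-- Some power of z • a has norm below 1, and 1 - z • a divides 1 minus that power. -/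
theorem isUnit_one_sub_smul_of_norm_pow_le {a : 𝓐} {C q : ℝ} {z : ℂ} (hq : 0 ≤ q)
    (h : ∀ n : ℕ, ‖a ^ (n + 1)‖ ≤ C * q ^ (n + 1)) (hz : ‖z‖ * q < 1) : IsUnit (1 - z • a) := by
  have hlim : Tendsto (fun n : ℕ => C * (‖z‖ * q) ^ (n + 1)) atTop (𝓝 0) := by
    rw [← mul_zero C]
    exact ((tendsto_pow_atTop_nhds_zero_of_lt_one (by positivity) hz).comp
      (tendsto_add_atTop_nat 1)).const_mul C
  obtain ⟨n, hn⟩ := (hlim.eventually_lt_const one_pos).exists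
  have hlt : ‖(z • a) ^ (n + 1)‖ < 1 := by
    refine lt_of_le_of_lt ?_ hn
    rw [smul_pow, norm_smul, norm_pow, mul_pow, mul_left_comm]
    gcongr
    exact h n
  have hu : IsUnit (1 - (z • a) ^ (n + 1)) := (Units.oneSub _ hlt).isUnit
  rw [← mul_neg_geom_sum] at hu
  refine ((Commute.isUnit_mul_iff ?_).1 hu).1
  refine (Commute.one_left _).sub_left (Commute.sum_right _ _ _ fun i _ => ?_)
  exact (Commute.refl _).pow_right i

end Laurent

/-! ### The equivalence for bounded operators. -/

section Bounded

variable {X : Type*} [NormedAddCommGroup X] [NormedSpace ℂ X]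

theorem isFredholm_total_mul_isUnit {S W : X →L[ℂ] X} (hW : IsUnit W)
    (hS : IsFredholm (total S)) : IsFredholm (total (S * W)) := by
  obtain ⟨W, rfl⟩ := hW
  obtain ⟨h₁, _, h₃⟩ := isFredholm_total.1 hS
  have hWinv : ∀ x, W.1 (W.2 x) = x := fun x => DFunLike.congr_fun W.3 x
  have hinvW : ∀ x, W.2 (W.1 x) = x := fun x => DFunLike.congr_fun W.4 x
  have hr : (S * W.1).range = S.range := by
    refine le_antisymm (fun y ⟨x, hx⟩ => ⟨W.1 x, hx⟩) fun y ⟨x, hx⟩ => ⟨W.2 x, ?_⟩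
    change S (W.1 (W.2 x)) = y
    rw [hWinv]
    exact hx
  have hk : FiniteDimensional ℂ (S * W.1).ker := by
    let g : (S * W.1).ker →ₗ[ℂ] S.ker :=
      (W.1.toLinearMap ∘ₗ (S * W.1).ker.subtype).codRestrict S.ker fun x => x.2
    refine FiniteDimensional.of_injective g fun x y hxy => Subtype.ext ?_
    have : W.1 (x : X) = W.1 (y : X) := congrArg (fun z : S.ker => (z : X)) hxy
    rw [← hinvW x, this, hinvW]
  exact isFredholm_total.2 ⟨hr.symm ▸ h₁, hk, hr.symm ▸ h₃⟩

theorem isFredholm_total_of_mul_isUnit {S W : X →L[ℂ] X} (hW : IsUnit W)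
    (h : IsFredholm (total (S * W))) : IsFredholm (total S) := by
  obtain ⟨W, rfl⟩ := hW
  have := isFredholm_total_mul_isUnit (W⁻¹).isUnit h
  rwa [mul_assoc, W.mul_inv, mul_one] at this

theorem isFredholm_total_of_isUnit {T : X →L[ℂ] X} (hT : IsUnit T) : IsFredholm (total T) := by
  have h1 : IsFredholm (total (1 : X →L[ℂ] X)) := by
    have hr : (1 : X →L[ℂ] X).range = ⊤ := LinearMap.range_id
    have hk : (1 : X →L[ℂ] X).ker = ⊥ := LinearMap.ker_id
    rw [isFredholm_total, hr, hk]
    exact ⟨isClosed_univ, inferInstance, inferInstance⟩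
  rw [← one_mul T]
  exact isFredholm_total_mul_isUnit hT h1

theorem isFredholm_total_of_mul {T P : X →L[ℂ] X} (hc : Commute T P)
    (h : IsFredholm (total (T * P))) : IsFredholm (total T) := by
  obtain ⟨h₁, _, _⟩ := isFredholm_total.1 h
  have hr : (T * P).range ≤ T.range := fun y ⟨x, hx⟩ => ⟨P x, hx⟩
  have hk : T.ker ≤ (T * P).ker := fun x hx => by
    have hx : T x = 0 := hx
    rw [hc.eq]
    change P (T x) = 0
    rw [hx, map_zero]
  refine isFredholm_total.2 ⟨Submodule.isClosed_mono_of_finiteDimensional_quotient h₁ hr,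
    Submodule.finiteDimensional_of_le hk, ?_⟩
  exact Module.Finite.of_surjective _ (Submodule.factor_surjective hr)

/-- Infinite dimension enters here: a Riesz operator must have 0 in its essential spectrum. -/
theorem not_isFredholm_total_of_finiteDimensional_range (hX : ¬ FiniteDimensional ℂ X)
    {T : X →L[ℂ] X} [FiniteDimensional ℂ T.range] : ¬ IsFredholm (total T) := by
  intro h
  obtain ⟨-, _, _⟩ := isFredholm_total.1 h
  exact hX (Module.Finite.of_submodule_quotient T.range)

theorem isRiesz_iff {T : X →L[ℂ] X} :
    IsRiesz T ↔ ¬ IsFredholm (total T) ∧ ∀ μ : ℂ, μ ≠ 0 → IsFredholm (total (T - μ • 1)) := by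
  have hmem : ∀ μ, μ ∈ essentialSpectrum (total T) ↔ ¬ IsFredholm (total (T - μ • 1)) := fun μ => by
    rw [essentialSpectrum, Set.mem_ofPred_eq, subScalar_total]
  have h0 : T - (0 : ℂ) • 1 = T := by rw [zero_smul, sub_zero]
  rw [IsRiesz, Set.ext_iff]
  change (∀ μ, μ ∈ essentialSpectrum (total T) ↔ _) ↔ _
  simp only [hmem, Set.mem_singleton_iff]
  constructor
  · intro h
    refine ⟨?_, fun μ hμ => by_contra fun hF => hμ ((h μ).1 hF)⟩
    have := (h 0).2 rfl
    rwa [h0] at this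
  · rintro ⟨h₁, h₂⟩ μ
    refine ⟨fun h => by_contra fun hμ => h (h₂ μ hμ), ?_⟩
    rintro rfl
    rwa [h0]

theorem isGeneralizedDrazinRieszInvertible_total_iff {T : X →L[ℂ] X} :
    IsGeneralizedDrazinRieszInvertible (total T) ↔
      ∃ B : X →L[ℂ] X, Commute T B ∧ B * T * B = B ∧ IsRiesz (T * (1 - T * B)) := by
  constructor
  · rintro ⟨B, hB, hAB, h₁, h₂, N, hN, hNR⟩
    refine ⟨B, ContinuousLinearMap.ext fun x => (h₂ ⟨x, trivial⟩).symm,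
      ContinuousLinearMap.ext h₁, ?_⟩
    have : N = T * (1 - T * B) := ContinuousLinearMap.ext hN
    rwa [← this]
  · rintro ⟨B, hc, hb, hR⟩
    exact ⟨B, fun _ => trivial, fun _ => trivial, fun x => DFunLike.congr_fun hb x,
      fun x => (DFunLike.congr_fun hc.eq (x : X)).symm, _, fun x => rfl, hR⟩

theorem not_accPt_browderSpectrum_total_iff {T : X →L[ℂ] X} :
    ¬ AccPt (0 : ℂ) (𝓟 (browderSpectrum (total T))) ↔
      ∀ᶠ μ in 𝓝[≠] (0 : ℂ), IsBrowder (total (T - μ • 1)) := by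
  rw [accPt_iff_frequently_nhdsNE, not_frequently]
  simp only [browderSpectrum, Set.mem_ofPred_eq, not_not, subScalar_total]

theorem isBrowder_total_sub_of_mem_closure [CompleteSpace X] {T : X →L[ℂ] X} {μ : ℂ}
    (hT : IsFredholm (total (T - μ • 1))) (h : μ ∈ closure {ν : ℂ | IsUnit (T - ν • 1)}) :
    IsBrowder (total (T - μ • 1)) := by
  refine isBrowder_total_of_mem_closure hT (mem_closure_iff_frequently.2 ?_)
  have ht : Tendsto (fun ν : ℂ => ν - μ) (𝓝 μ) (𝓝 0) := by
    have : Continuous fun ν : ℂ => ν - μ := by fun_prop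
    simpa using this.tendsto μ
  refine ht.frequently ((mem_closure_iff_frequently.1 h).mono fun ν hν => ?_)
  have : T - μ • 1 - (ν - μ) • 1 = T - ν • 1 := by rw [sub_smul]; abel
  rwa [Set.mem_ofPred_eq, this]

theorem eventually_isUnit_sub_of_isBrowder [CompleteSpace X] {T : X →L[ℂ] X} {μ : ℂ}
    (hT : IsBrowder (total (T - μ • 1))) : ∀ᶠ ν in 𝓝[≠] μ, IsUnit (T - ν • 1) := by
  have ht : Tendsto (fun ν : ℂ => ν - μ) (𝓝[≠] μ) (𝓝[≠] 0) := by
    have : Continuous fun ν : ℂ => ν - μ := by fun_prop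
    refine tendsto_nhdsWithin_iff.2 ⟨?_, ?_⟩
    · exact Tendsto.mono_left (by simpa using this.tendsto μ) nhdsWithin_le_nhds
    · filter_upwards [self_mem_nhdsWithin] with ν hν
      exact sub_ne_zero.2 hν
  filter_upwards [ht.eventually (eventually_isUnit_of_isBrowder hT)] with ν hν
  have : T - μ • 1 - (ν - μ) • 1 = T - ν • 1 := by rw [sub_smul]; abel
  rwa [this] at hν

theorem mem_resolventSet_iff_isUnit_sub {T : X →L[ℂ] X} {μ : ℂ} :
    μ ∈ resolventSet ℂ T ↔ IsUnit (T - μ • 1) := by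
  rw [spectrum.mem_resolventSet_iff, Algebra.algebraMap_eq_smul_one, ← IsUnit.neg_iff, neg_sub]

/-- On a connected set of the essential resolvent set which meets the resolvent set, every point is
a limit of points of the resolvent set. -/
theorem subset_closure_of_isPreconnected [CompleteSpace X] {T : X →L[ℂ] X} {Ω : Set ℂ}
    (hΩ : IsPreconnected Ω) (hF : ∀ μ ∈ Ω, IsFredholm (total (T - μ • 1)))
    (hne : ∃ μ ∈ Ω, IsUnit (T - μ • 1)) : Ω ⊆ closure {ν : ℂ | IsUnit (T - ν • 1)} := by
  set ρ : Set ℂ := {ν : ℂ | IsUnit (T - ν • 1)}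
  have hρ : IsOpen ρ := by
    have : Continuous fun ν : ℂ => T - ν • (1 : X →L[ℂ] X) := by fun_prop
    exact Units.isOpen.preimage this
  -- Connectedness argument: a point of Ω in the closure of ρ is Browder, so a punctured
  -- neighbourhood of it lies in ρ.
  refine (hΩ.subset_of_closure_inter_subset (u := interior (closure ρ)) isOpen_interior ?_ ?_).trans
    interior_subset
  · obtain ⟨μ, hμ, hu⟩ := hne
    exact ⟨μ, hμ, hρ.subset_interior_closure hu⟩
  · rintro μ ⟨hμ, hμΩ⟩
    have hμc : μ ∈ closure ρ := closure_minimal interior_subset isClosed_closure hμ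
    have hev := eventually_isUnit_sub_of_isBrowder
      (isBrowder_total_sub_of_mem_closure (hF μ hμΩ) hμc)
    rw [mem_interior_iff_mem_nhds]
    rw [eventually_nhdsWithin_iff] at hev
    filter_upwards [hev] with ν hν
    by_cases hνμ : ν = μ
    · exact hνμ ▸ hμc
    · exact subset_closure (hν hνμ)

theorem eventually_isBrowder_of_outerInverse [CompleteSpace X] {T B : X →L[ℂ] X}
    (hc : Commute T B) (hb : B * T * B = B) (hR : IsRiesz (T * (1 - T * B))) :
    ∀ᶠ μ in 𝓝[≠] (0 : ℂ), IsBrowder (total (T - μ • 1)) := by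
  set N := T * (1 - T * B)
  have hN := (isRiesz_iff.1 hR).2
  have hΩ : ({0}ᶜ : Set ℂ) ⊆ closure {ν : ℂ | IsUnit (N - ν • 1)} := by
    refine subset_closure_of_isPreconnected
      (isConnected_compl_singleton_of_one_lt_rank (by simp) 0).isPreconnected hN ?_
    obtain ⟨μ, hμ⟩ : ∃ μ : ℂ, ‖N‖ * ‖(1 : X →L[ℂ] X)‖ < ‖μ‖ :=
      NormedField.exists_lt_norm ℂ _
    refine ⟨μ, ?_, mem_resolventSet_iff_isUnit_sub.1 (spectrum.mem_resolventSet_of_norm_lt_mul hμ)⟩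
    rintro rfl
    rw [norm_zero] at hμ
    exact absurd hμ (not_lt.2 (by positivity))
  have hcont : Continuous fun μ : ℂ => 1 - μ • B := by fun_prop
  have hu : ∀ᶠ μ in 𝓝 (0 : ℂ), IsUnit (1 - μ • B) :=
    hcont.continuousAt.eventually_mem (Units.isOpen.mem_nhds (by simp))
  -- The factorization is needed at μ and at all nearby ν, to carry resolvent points of N over to T.
  filter_upwards [nhdsWithin_le_nhds hu.eventually_nhds, self_mem_nhdsWithin] with μ hμ hμ0
  obtain ⟨W, hW, hTW⟩ := exists_isUnit_sub_eq_mul hμ0 hc hb hμ.self_of_nhds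
  refine isBrowder_total_sub_of_mem_closure ?_ ?_
  · rw [hTW]
    exact isFredholm_total_mul_isUnit hW (hN μ hμ0)
  · rw [mem_closure_iff_frequently]
    have hne : ∀ᶠ ν in 𝓝 μ, ν ≠ 0 := isOpen_ne.mem_nhds hμ0
    refine ((mem_closure_iff_frequently.1 (hΩ hμ0)).and_eventually (hμ.and hne)).mono ?_
    rintro ν ⟨hν, hνu, hν0⟩
    obtain ⟨W', hW', hTW'⟩ := exists_isUnit_sub_eq_mul hν0 hc hb hνu
    rw [Set.mem_ofPred_eq, hTW']
    exact IsUnit.mul hν hW'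

/-- Browder points are isolated in the spectrum or outside it, so a compact annulus contains
finitely many spectral points; a thin annulus avoids their moduli. -/
theorem exists_annulus_subset_resolventSet [CompleteSpace X] {T : X →L[ℂ] X} {ε : ℝ} (hε : 0 < ε)
    (h : ∀ μ : ℂ, μ ≠ 0 → ‖μ‖ < ε → IsBrowder (total (T - μ • 1))) :
    ∃ r s : ℝ, 0 < r ∧ r < s ∧ s < ε ∧ ∀ z : ℂ, r ≤ ‖z‖ → ‖z‖ ≤ s → z ∈ resolventSet ℂ T := by
  let K : Set ℂ := {z | ε / 3 ≤ ‖z‖ ∧ ‖z‖ ≤ 2 * ε / 3} ∩ spectrum ℂ T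
  have hKc : IsCompact K := by
    refine (spectrum.isCompact T).inter_left ?_
    exact (isClosed_le continuous_const continuous_norm).inter
      (isClosed_le continuous_norm continuous_const)
  have hKf : K.Finite := by
    by_contra hinf
    obtain ⟨x, hx, hacc⟩ := Set.Infinite.exists_accPt_of_subset_isCompact hinf hKc subset_rfl
    have hx0 : x ≠ 0 := by
      rintro rfl
      have := hx.1.1
      rw [norm_zero] at this
      linarith
    have hev := eventually_isUnit_sub_of_isBrowder (h x hx0 (by linarith [hx.1.2]))
    rw [accPt_iff_frequently_nhdsNE] at hacc
    obtain ⟨y, hy, hyu⟩ := (hacc.and_eventually hev).exists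
    exact hy.2 (mem_resolventSet_iff_isUnit_sub.2 hyu)
  have hfin : (norm '' K).Finite := hKf.image _
  obtain ⟨c, hc, hcK⟩ : ∃ c ∈ Set.Ioo (ε / 3) (2 * ε / 3), c ∉ norm '' K :=
    (Set.Ioo_infinite (by linarith)).exists_notMem_finite hfin
  have hnhds : Set.Ioo (ε / 3) (2 * ε / 3) \ norm '' K ∈ 𝓝 c :=
    (isOpen_Ioo.sdiff hfin.isClosed).mem_nhds ⟨hc, hcK⟩
  obtain ⟨δ, hδ, hball⟩ := Metric.nhds_basis_closedBall.mem_iff.1 hnhds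
  rw [Real.closedBall_eq_Icc] at hball
  have h₁ := (hball ⟨le_rfl, by linarith⟩).1
  have h₂ := (hball ⟨by linarith, le_rfl⟩).1
  refine ⟨c - δ, c + δ, by linarith [h₁.1], by linarith, by linarith [h₂.2], fun z hz₁ hz₂ => ?_⟩
  have hz := hball ⟨hz₁, hz₂⟩
  by_contra hzs
  exact hz.2 ⟨z, ⟨⟨hz.1.1.le, hz.1.2.le⟩, hzs⟩, rfl⟩

theorem exists_outerInverse_of_isBrowder [CompleteSpace X] (hX : ¬ FiniteDimensional ℂ X)
    {T : X →L[ℂ] X} (hT : IsBrowder (total T)) :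
    ∃ B : X →L[ℂ] X, Commute T B ∧ B * T * B = B ∧ IsRiesz (T * (1 - T * B)) := by
  obtain ⟨F, hFF, hc, hfin, hnil, V, hV⟩ := exists_idempotent_of_isBrowder hT
  set U : X →L[ℂ] X := ((V⁻¹ : (X →L[ℂ] X)ˣ) : X →L[ℂ] X) with hU
  have hTV : Commute (V : X →L[ℂ] X) T := by
    rw [hV]; exact (Commute.refl T).add_left hc.symm
  have hFV : Commute (V : X →L[ℂ] X) F := by
    rw [hV]; exact hc.add_left (Commute.refl F)
  have hTU : Commute T U := hTV.units_inv_left.symm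
  have hFU : Commute F U := hFV.units_inv_left.symm
  have hF1 : (1 - F) * (1 - F) = 1 - F := by
    rw [mul_sub, mul_one, sub_mul, one_mul, hFF, sub_self, sub_zero]
  have hTB : T * (U * (1 - F)) = 1 - F := by
    have h₁ : T * (1 - F) = V * (1 - F) := by
      rw [hV, add_mul, mul_sub F, mul_one, hFF, sub_self, add_zero]
    rw [← mul_assoc, hTU.eq, mul_assoc, h₁, ← mul_assoc, hU, V.inv_mul, one_mul]
  have hcB : Commute T (U * (1 - F)) := hTU.mul_right ((Commute.one_right T).sub_right hc)
  refine ⟨U * (1 - F), hcB, ?_, ?_⟩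
  · rw [mul_assoc, hTB, mul_assoc, hF1]
  · rw [hTB, sub_sub_cancel, isRiesz_iff]
    constructor
    · have : FiniteDimensional ℂ (T * F).range := by
        have hle : (T * F).range ≤ F.range := by
          rw [hc.eq]
          exact fun y ⟨x, hx⟩ => ⟨T x, hx⟩
        exact Submodule.finiteDimensional_of_le hle
      exact not_isFredholm_total_of_finiteDimensional_range hX
    · intro μ hμ
      apply isFredholm_total_of_isUnit
      have h1 : IsUnit (μ • (1 : X →L[ℂ] X)) := by
        rw [← Algebra.algebraMap_eq_smul_one]
        exact (Ne.isUnit hμ).map (algebraMap ℂ (X →L[ℂ] X))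
      have := hnil.isUnit_add_right_of_commute h1.neg
        ((Commute.one_right (T * F)).smul_right μ).neg_right
      rwa [← sub_eq_add_neg] at this

theorem exists_outerInverse_of_not_isFredholm [CompleteSpace X] {T : X →L[ℂ] X}
    (hT : ¬ IsFredholm (total T)) {ε : ℝ} (hε : 0 < ε)
    (h : ∀ μ : ℂ, μ ≠ 0 → ‖μ‖ < ε → IsBrowder (total (T - μ • 1))) :
    ∃ B : X →L[ℂ] X, Commute T B ∧ B * T * B = B ∧ IsRiesz (T * (1 - T * B)) := by
  obtain ⟨r, s, hr, hrs, hsε, hann⟩ := exists_annulus_subset_resolventSet hε h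
  obtain ⟨B, hc, hb, C, hC⟩ := exists_outerInverse_of_annulus hr hrs hann
  have hs : 0 < s := hr.trans hrs
  refine ⟨B, hc, hb, isRiesz_iff.2 ⟨fun hN => hT (isFredholm_total_of_mul ?_ hN), fun μ hμ => ?_⟩⟩
  · exact (Commute.one_right T).sub_right ((Commute.refl T).mul_right hc)
  have hμn : 0 < ‖μ‖ := norm_pos_iff.2 hμ
  -- For |μ| < s, Fredholmness transfers from T - μ; for |μ| ≥ s > r, μ exceeds the spectral radius
  -- of N.
  rcases lt_or_ge ‖μ‖ s with hlt | hge
  · have hu : IsUnit (1 - μ • B) :=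
      isUnit_one_sub_smul_of_norm_pow_le (inv_nonneg.2 hs.le) (fun n => (hC n).2) (by
        rwa [← div_eq_mul_inv, div_lt_one hs])
    obtain ⟨W, hW, hTW⟩ := exists_isUnit_sub_eq_mul hμ hc hb hu
    refine isFredholm_total_of_mul_isUnit hW ?_
    rw [← hTW]
    exact (h μ hμ (hlt.trans hsε)).isFredholm
  · apply isFredholm_total_of_isUnit
    have hu : IsUnit (1 - μ⁻¹ • (T * (1 - T * B))) :=
      isUnit_one_sub_smul_of_norm_pow_le hr.le (fun n => (hC n).1) (by
        rw [norm_inv, inv_mul_lt_one₀ hμn]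
        exact hrs.trans_le hge)
    have hm : IsUnit (algebraMap ℂ (X →L[ℂ] X) (-μ)) :=
      (Ne.isUnit (neg_ne_zero.2 hμ)).map (algebraMap ℂ (X →L[ℂ] X))
    have := hm.mul hu
    rwa [← Algebra.smul_def, smul_sub, smul_smul, neg_mul, mul_inv_cancel₀ hμ, neg_smul, neg_smul,
      one_smul, sub_neg_eq_add, neg_add_eq_sub] at this

theorem isGeneralizedDrazinRieszInvertible_total [CompleteSpace X] (hX : ¬ FiniteDimensional ℂ X)
    (T : X →L[ℂ] X) :
    IsGeneralizedDrazinRieszInvertible (total T) ↔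
      ¬ AccPt (0 : ℂ) (𝓟 (browderSpectrum (total T))) := by
  rw [isGeneralizedDrazinRieszInvertible_total_iff, not_accPt_browderSpectrum_total_iff]
  constructor
  · rintro ⟨B, hc, hb, hR⟩
    exact eventually_isBrowder_of_outerInverse hc hb hR
  · intro h
    by_cases hT : IsFredholm (total T)
    · refine exists_outerInverse_of_isBrowder hX (isBrowder_total_of_mem_closure hT ?_)
      -- Each nearby Browder point is a limit of resolvent points, so 0 is too.
      have hsub : ∀ᶠ μ in 𝓝[≠] (0 : ℂ), μ ∈ closure {ν : ℂ | IsUnit (T - ν • 1)} := by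
        filter_upwards [h] with μ hμ
        rw [mem_closure_iff_frequently]
        exact (eventually_isUnit_sub_of_isBrowder hμ).frequently.filter_mono nhdsWithin_le_nhds
      rw [← closure_closure, mem_closure_iff_frequently]
      exact hsub.frequently.filter_mono nhdsWithin_le_nhds
    · rw [eventually_nhdsWithin_iff] at h
      obtain ⟨ε, hε, hball⟩ := Metric.eventually_nhds_iff.1 h
      refine exists_outerInverse_of_not_isFredholm hT hε fun μ hμ hμε => hball ?_ hμ
      rwa [dist_zero_right]

end Bounded

end UnboundedOp

theorem mainTheorem1 {X : Type*} [NormedAddCommGroup X] [NormedSpace ℂ X] [CompleteSpace X]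
    (hX : ¬ FiniteDimensional ℂ X)
    (A : X →ₗ.[ℂ] X) (hclosed : A.IsClosed) (hdense : Dense (A.domain : Set X))
    (hess : (UnboundedOp.essentialResolvent A).Nonempty)
    (hdom : ∀ᶠ j : ℕ in atTop,
      (UnboundedOp.pow A (j + 1)).domain = (UnboundedOp.pow A j).domain) :
    UnboundedOp.IsGeneralizedDrazinRieszInvertible A ↔
      ¬ AccPt (0 : ℂ) (𝓟 (UnboundedOp.browderSpectrum A)) := by
  obtain ⟨T, rfl⟩ := UnboundedOp.exists_eq_total hclosed
    (UnboundedOp.domain_eq_top hclosed hdense hess hdom)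
  exact UnboundedOp.isGeneralizedDrazinRieszInvertible_total hX T
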